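/- Let $I=(0,1)$, and let $\lambda_n>0$, $\delta_n>0$ be sequences with $\lambda_n\to0$, $\delta_n\to0$ and $\lambda_n/\sqrt{\delta_n}\to0$. Put $N_n=\lfloor 1/\lambda_n\rfloor$. Let $\overline{\mathcal U}_n$ be the set of spin chains $u:\{0,\dots,N_n\}\to S^2\subset\mathbb R^3$ with $(u^1,u^0)=(u^{N_n},u^{N_n-1})$, where $(\cdot,\cdot)$ is the scalar product. The energy of $u\in\overline{\mathcal U}_n$ is $$H_n^{sl}(u)=\frac12\sum_{i=0}^{N_n-2}\lambda_n\left|u^{i+2}-2(1-\delta_n)u^{i+1}+u^i\right|^2 .$$ The chirality field $T_n(u)\in L^1(I,\mathbb R^3)$ of $u$ is the piecewise constant function with value $$z^i=\frac{u^i\times u^{i+1}}{\sqrt{2\delta_n}}$$ on $\lambda_n(i+[0,1))\cap I$ for $i=0,\dots,N_n-1$, and with the last value $z^{N_n-1}$ on the remainder $[\lambda_nN_n,1)$. For $z\in L^1(I,\mathbb R^3)$ let $H_n^{sl}(z)=\inf\{H_n^{sl}(u):u\in\overline{\mathcal U}_n,\ T_n(u)=z\}$, with $\inf\emptyset=+\infty$.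 For $R>1$ let $H_n^{sl,R}(z)=H_n^{sl}(z)$ if $\|z\|_\infty\le R$, and $H_n^{sl,R}(z)=+\infty$ otherwise. **Theorem.** For every $R>1$, the functionals $$\frac{H_n^{sl,R}}{\sqrt2\,\lambda_n\,\delta_n^{3/2}}:L^1(I,\mathbb R^3)\to[0,+\infty]$$ $\Gamma$-converge, with respect to weak* convergence in $L^\infty(I,\mathbb R^3)$, to the functional $$H^{sl}(z)=\begin{cases}0&\text{if }|z|\le1\text{ almost everywhere in }I,\\+\infty&\text{otherwise.}\end{cases}$$ That is, (i) whenever $z_n\rightharpoonup^* z$ in $L^\infty(I,\mathbb R^3)$, one has $$H^{sl}(z)\le\liminf_{n}\frac{H_n^{sl,R}(z_n)}{\sqrt2\,\lambda_n\delta_n^{3/2}};$$ and (ii) for every $z$ with $H^{sl}(z)<+\infty$ there are $z_n\rightharpoonup^* z$ in $L^\infty(I,\mathbb R^3)$ with $$\limsup_{n}\frac{H_n^{sl,R}(z_n)}{\sqrt2\,\lambda_n\delta_n^{3/2}}\le H^{sl}(z).$$ -/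

import Mathlib

open MeasureTheory Filter Topology
open scoped ENNReal

noncomputable section

namespace SpinChain

/-- Euclidean three-space. -/
abbrev E3 : Type := EuclideanSpace ℝ (Fin 3)

/-- The unit sphere `S²` of `ℝ³`. -/
abbrev S2 : Type := Metric.sphere (0 : E3) 1

/-- Lebesgue measure on `I = (0,1)`. -/
abbrev muI : Measure ℝ := volume.restrict (Set.Ioo (0 : ℝ) 1)

/-- The space `L¹(I, ℝ³)`. -/
abbrev L1I : Type := Lp E3 1 muI

/-- The cross product of `ℝ³`. -/
def cross (a b : E3) : E3 := WithLp.toLp 2 (crossProduct (WithLp.ofLp a) (WithLp.ofLp b))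

/-- The last lattice index `[1/lam]`: the integers `i` with `lam * i ∈ [0,1]` are `0, …, [1/lam]`
(see `le_lastIndex_iff`). -/
def lastIndex (lam : ℝ) : ℕ := ⌊1 / lam⌋₊

theorem le_lastIndex_iff {lam : ℝ} (h : 0 < lam) (i : ℕ) :
    i ≤ lastIndex lam ↔ lam * i ∈ Set.Icc (0 : ℝ) 1 := by
  unfold lastIndex
  rw [Nat.le_floor_iff (by positivity), le_div_iff₀ h, mul_comm, Set.mem_Icc]
  exact ⟨fun h1 => ⟨by positivity, h1⟩, fun h1 => h1.2⟩

/-- The indices `i` such that both `i` and `i + 2` are lattice indices, that is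
`i = 0, …, [1/lam] - 2` (see `mem_innerIndices_iff`). -/
def innerIndices (lam : ℝ) : Finset ℕ := Finset.range (lastIndex lam - 1)

theorem mem_innerIndices_iff {lam : ℝ} (h : 0 < lam) (i : ℕ) :
    i ∈ innerIndices lam ↔
      lam * i ∈ Set.Icc (0 : ℝ) 1 ∧ lam * ((i + 2 : ℕ) : ℝ) ∈ Set.Icc (0 : ℝ) 1 := by
  rw [← le_lastIndex_iff h, ← le_lastIndex_iff h]
  unfold innerIndices
  rw [Finset.mem_range]
  omega

/-- The boundary condition `(u¹, u⁰) = (u^N, u^{N-1})`, `N = [1/lam]`. A spin configuration is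
written as `u : ℕ → S²`; only its values at the lattice indices `0, …, N` are ever used. -/
def BoundaryCondition (lam : ℝ) (u : ℕ → S2) : Prop :=
  inner ℝ (u 1 : E3) (u 0 : E3) =
    inner ℝ (u (lastIndex lam) : E3) (u (lastIndex lam - 1) : E3)

/-- The renormalized energy of a chain,
`½ ∑ lam |u^{i+2} - 2 (1 - δ) u^{i+1} + u^i|²`, over all `i` with `i, i + 2` lattice indices. -/
def chainEnergy (lam δ : ℝ) (u : ℕ → S2) : ℝ :=
  (1 / 2) * ∑ i ∈ innerIndices lam,
    lam * ‖(u (i + 2) : E3) - (2 * (1 - δ)) • (u (i + 1) : E3) + (u i : E3)‖ ^ 2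

/-- The chirality `z^i = (u^i × u^{i+1}) / √(2δ)` of a configuration at the index `i`. -/
def chirality (δ : ℝ) (u : ℕ → S2) (i : ℕ) : E3 :=
  (Real.sqrt (2 * δ))⁻¹ • cross (u i : E3) (u (i + 1) : E3)

/-- The piecewise constant interpolation of the chirality, equal to `z^i` on `lam * (i + [0,1))`
for `i = 0, …, N - 1`, `N = [1/lam]`. On the remainder `[lam * N, 1)`, where `z^N` would involve
the nonexistent spin `u^{N+1}`, the last value `z^{N-1}` is repeated. -/
def chiralityField (lam δ : ℝ) (u : ℕ → S2) (x : ℝ) : E3 :=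
  chirality δ u (min ⌊x / lam⌋₊ (lastIndex lam - 1))

/-- The sliced energy as a functional of the chirality field: the infimum of the energies of all
configurations satisfying the boundary condition whose chirality field is `z`
(`⊤` if there are none). -/
def Hsl (lam δ : ℝ) (z : L1I) : ℝ≥0∞ :=
  ⨅ (u : ℕ → S2) (_ : BoundaryCondition lam u) (_ : z =ᵐ[muI] chiralityField lam δ u),
    ENNReal.ofReal (chainEnergy lam δ u)

open Classical in
/-- The sliced energy restricted to the fields with `‖z‖_∞ ≤ R`. -/
def HslR (R lam δ : ℝ) (z : L1I) : ℝ≥0∞ :=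
  if eLpNorm z ∞ muI ≤ ENNReal.ofReal R then Hsl lam δ z else ⊤

/-- The rescaled functional `H^{sl,R} / (√2 lam δ^{3/2})`. -/
def scaledHslR (R lam δ : ℝ) (z : L1I) : ℝ≥0∞ :=
  HslR R lam δ z / ENNReal.ofReal (Real.sqrt 2 * lam * δ ^ (3 / 2 : ℝ))

open Classical in
/-- The limit functional: `0` on `L^∞(I, B(0,1))`, with the closed unit ball, and `⊤` elsewhere. -/
def limitFunctional (z : L1I) : ℝ≥0∞ :=
  if ∀ᵐ x ∂muI, z x ∈ Metric.closedBall (0 : E3) 1 then 0 else ⊤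

/-- Weak* convergence in `L^∞(I, ℝ³)`: all the functions belong to `L^∞` and their pairings with
every `φ ∈ L¹(I, ℝ³)` converge. -/
def WeakStarTendsto (z : ℕ → L1I) (z₀ : L1I) : Prop :=
  (∀ n, MemLp (z n) ∞ muI) ∧ MemLp z₀ ∞ muI ∧
    ∀ φ : L1I, Tendsto (fun n => ∫ x, inner ℝ (z n x) (φ x) ∂muI) atTop
      (𝓝 (∫ x, inner ℝ (z₀ x) (φ x) ∂muI))

/-- Sequential `Γ`-convergence of `F n` to `F₀` with respect to a notion `conv` of convergence of
sequences. The upper bound is void at the points where `F₀ = ⊤`. -/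
structure GammaConverges {X : Type*} (conv : (ℕ → X) → X → Prop) (F : ℕ → X → ℝ≥0∞)
    (F₀ : X → ℝ≥0∞) : Prop where
  liminf_ineq : ∀ (x : X) (xs : ℕ → X), conv xs x → F₀ x ≤ liminf (fun n => F n (xs n)) atTop
  recovery : ∀ x : X, F₀ x ≠ ⊤ →
    ∃ xs : ℕ → X, conv xs x ∧ limsup (fun n => F n (xs n)) atTop ≤ F₀ x

end SpinChain

end

/-! Everything rests on one identity. For a unit vector b, the squared norm of c - k b + a is |b × c
- a × b|² + ((a,b) + (b,c) - k)² (`norm_second_difference_sq`). With k = 2(1 - δ), the energy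
controls both the jumps of the chirality and the deviation of consecutive scalar products, on
average, from 1 - δ.

Lower bound: if D is the second difference at i, both chiralities that it involves have length at
most 1 + |D|/δ (`norm_chirality_le`). By Cauchy-Schwarz, an energy of order lam δ^{3/2} makes the L¹
norm of the excess |D|/δ at most of order (lam/√δ)^{1/2}, which tends to 0
(`integral_secondDiff_le`). Weak* limits therefore stay in the unit ball.

Upper bound: sphere-valued fields oscillate weakly* to any field in the ball. A simple function is
made unit-valued by adding a fast rotation in the orthogonal plane (`exists_sphere_valued_tendsto`),
and the result is smoothed to a C^{1,1} curve e on the sphere. Along e there is a chain with u_i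
orthogonal to e(lam i) and (u_i, u_{i+1}) = 1 - δ (`exists_isAdapted`). Its chirality is close to e,
and the scalar term of the identity vanishes. The other term is controlled by (e_{i+1}, u_i) +
(e_{i+1}, u_{i+2}). Each summand is only O(lam), but orthogonality at i and i+2 cancels the leading
order and leaves O(lam √δ). The energy is then O(lam² δ), that is lam/√δ relative to the scaling. A
diagonal argument over a countable dense set of test fields concludes. -/

noncomputable section

namespace SpinChain

/-! ### The cross product -/

theorem inner_cross_cross (a b c d : E3) :
    inner ℝ (cross a b) (cross c d)
      = inner ℝ a c * inner ℝ b d - inner ℝ a d * inner ℝ b c := by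
  simp [cross, crossProduct, PiLp.inner_apply, Fin.sum_univ_three]
  ring

theorem norm_cross_sq (a b : E3) : ‖cross a b‖ ^ 2 = ‖a‖ ^ 2 * ‖b‖ ^ 2 - inner ℝ a b ^ 2 := by
  rw [← real_inner_self_eq_norm_sq, inner_cross_cross, real_inner_self_eq_norm_sq,
    real_inner_self_eq_norm_sq, real_inner_comm a b]
  ring

theorem inner_cross_left_self (a b : E3) : inner ℝ a (cross a b) = 0 := by
  simp [cross, crossProduct, PiLp.inner_apply, Fin.sum_univ_three]
  ring

theorem inner_cross_right_self (a b : E3) : inner ℝ b (cross a b) = 0 := by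
  simp [cross, crossProduct, PiLp.inner_apply, Fin.sum_univ_three]
  ring

theorem inner_cross_rotate (a b c : E3) : inner ℝ a (cross b c) = inner ℝ c (cross a b) := by
  simp [cross, crossProduct, PiLp.inner_apply, Fin.sum_univ_three]
  ring

theorem cross_add_right (a b c : E3) : cross a (b + c) = cross a b + cross a c := by
  simp [cross]

theorem cross_smul_right (r : ℝ) (a b : E3) : cross a (r • b) = r • cross a b := by
  simp [cross]

theorem cross_self_eq_zero (a : E3) : cross a a = 0 := by
  simp [cross]

theorem cross_swap (a b : E3) : cross b a = -cross a b := by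
  simp [cross, ← WithLp.toLp_neg]

/-- The second difference of a chain splits into the increment of the cross products and its
component along the middle spin. -/
theorem norm_second_difference_sq (a b c : E3) (hb : ‖b‖ = 1) (k : ℝ) :
    ‖c - k • b + a‖ ^ 2 = ‖cross b c - cross a b‖ ^ 2
      + (inner ℝ a b + inner ℝ b c - k) ^ 2 := by
  have h1 : cross b (c - k • b + a) = cross b c - cross a b := by
    rw [sub_eq_add_neg, ← neg_smul, cross_add_right, cross_add_right, cross_smul_right,
      cross_self_eq_zero, cross_swap a b]
    simp [sub_eq_add_neg]
  have h2 : inner ℝ b (c - k • b + a) = inner ℝ a b + inner ℝ b c - k := by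
    rw [inner_add_right, inner_sub_right, inner_smul_right, real_inner_self_eq_norm_sq, hb,
      real_inner_comm a b]
    ring
  have h3 := norm_cross_sq b (c - k • b + a)
  rw [h1, h2, hb] at h3
  linarith

/-! ### Lower bound -/

/-- The second difference whose squared norm enters the energy. -/
def secondDiff (δ : ℝ) (u : ℕ → S2) (i : ℕ) : E3 :=
  (u (i + 2) : E3) - (2 * (1 - δ)) • (u (i + 1) : E3) + (u i : E3)

theorem norm_S2 (a : S2) : ‖(a : E3)‖ = 1 := by
  have := a.2
  rwa [mem_sphere_zero_iff_norm] at this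

theorem norm_chirality_sq {δ : ℝ} (hδ : 0 < δ) (u : ℕ → S2) (i : ℕ) :
    ‖chirality δ u i‖ ^ 2 = (1 - inner ℝ (u i : E3) (u (i + 1) : E3) ^ 2) / (2 * δ) := by
  rw [chirality, norm_smul, mul_pow, norm_cross_sq, norm_S2, norm_S2, norm_inv, inv_pow,
    Real.norm_eq_abs, sq_abs, Real.sq_sqrt (by positivity)]
  ring

theorem norm_chirality_sub_sq_le {δ : ℝ} (hδ : 0 < δ) (u : ℕ → S2) (i : ℕ) :
    ‖chirality δ u (i + 1) - chirality δ u i‖ ^ 2 ≤ ‖secondDiff δ u i‖ ^ 2 / (2 * δ) := by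
  rw [chirality, chirality, ← smul_sub, norm_smul, mul_pow, norm_inv, inv_pow,
    Real.norm_eq_abs, sq_abs, Real.sq_sqrt (by positivity), secondDiff,
    norm_second_difference_sq _ _ _ (norm_S2 _), inv_mul_eq_div]
  gcongr
  exact le_add_of_nonneg_right (sq_nonneg _)

/-- Since 1 - c² ≤ 2(1 - c), the left side is at most (2 - c - d)/δ for the two scalar products c,
d, and the scalar term of the identity bounds c + d from below. -/
theorem norm_chirality_sq_add_le {δ : ℝ} (hδ : 0 < δ) (u : ℕ → S2) (i : ℕ) :
    ‖chirality δ u i‖ ^ 2 + ‖chirality δ u (i + 1)‖ ^ 2 ≤ 2 + ‖secondDiff δ u i‖ / δ := by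
  rw [norm_chirality_sq hδ, norm_chirality_sq hδ]
  have h := norm_second_difference_sq (u i : E3) (u (i + 1)) (u (i + 2)) (norm_S2 _) (2 * (1 - δ))
  have h2 : |inner ℝ (u i : E3) (u (i + 1) : E3) + inner ℝ (u (i + 1) : E3) (u (i + 2) : E3)
      - 2 * (1 - δ)| ≤ ‖secondDiff δ u i‖ := by
    rw [← abs_norm (secondDiff δ u i)]
    apply sq_le_sq.1
    rw [secondDiff, h]
    exact le_add_of_nonneg_left (sq_nonneg _)
  have h3 := (abs_le.1 h2).1
  set c := inner ℝ (u i : E3) (u (i + 1) : E3)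
  set d := inner ℝ (u (i + 1) : E3) (u (i + 2) : E3)
  change (1 - c ^ 2) / (2 * δ) + (1 - d ^ 2) / (2 * δ) ≤ _
  rw [← add_div, div_le_iff₀ (by positivity)]
  have : (2 + ‖secondDiff δ u i‖ / δ) * (2 * δ) = 4 * δ + 2 * ‖secondDiff δ u i‖ := by
    field_simp
    ring
  rw [this]
  nlinarith [sq_nonneg (1 - c), sq_nonneg (1 - d)]

/-- The sum of squares bounds only the mean of p and q, by 1 + s/4 with s = t/δ; the bound on p - q
transfers this to p itself. -/
theorem norm_le_of_sq_add_sq_le {p q t δ : ℝ} (ht : 0 ≤ t) (hδ : 0 < δ)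
    (hδ1 : δ ≤ 1) (h1 : p ^ 2 + q ^ 2 ≤ 2 + t / δ) (h2 : (p - q) ^ 2 ≤ t ^ 2 / (2 * δ)) :
    p ≤ 1 + t / δ := by
  have hs : 0 ≤ t / δ := by positivity
  have h3 : t ^ 2 / (2 * δ) ≤ (t / δ) ^ 2 / 2 := by
    rw [div_pow, div_div, div_le_div_iff₀ (by positivity) (by positivity)]
    have : δ ^ 2 ≤ δ := by nlinarith
    nlinarith [sq_nonneg t]
  set s := t / δ
  have h4 : (p + q) / 2 ≤ 1 + s / 4 :=
    (abs_le_of_sq_le_sq' (by nlinarith [sq_nonneg (p - q), sq_nonneg s]) (by positivity)).2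
  have h5 : p - q ≤ 3 * s / 4 :=
    (abs_le_of_sq_le_sq' (by nlinarith [sq_nonneg s]) (by positivity)).2
  linarith

theorem norm_chirality_le {δ : ℝ} (hδ : 0 < δ) (hδ1 : δ ≤ 1) (u : ℕ → S2) (i : ℕ) :
    ‖chirality δ u i‖ ≤ 1 + ‖secondDiff δ u i‖ / δ ∧
      ‖chirality δ u (i + 1)‖ ≤ 1 + ‖secondDiff δ u i‖ / δ := by
  have h1 := norm_chirality_sq_add_le hδ u i
  have h2 := norm_chirality_sub_sq_le hδ u i
  have h3 : (‖chirality δ u (i + 1)‖ - ‖chirality δ u i‖) ^ 2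
      ≤ ‖secondDiff δ u i‖ ^ 2 / (2 * δ) :=
    le_trans (sq_le_sq.2 (by rw [abs_norm]; exact abs_norm_sub_norm_le _ _)) h2
  refine ⟨norm_le_of_sq_add_sq_le (norm_nonneg _) hδ hδ1 h1 ?_,
    norm_le_of_sq_add_sq_le (norm_nonneg _) hδ hδ1 ?_ h3⟩
  · rwa [← neg_sub, neg_sq]
  · rwa [add_comm] at h1

/-! ### Step functions and their integrals on the unit interval -/

instance isProbabilityMeasure_muI : IsProbabilityMeasure muI :=
  ⟨by simp [muI]⟩

theorem measurable_cellIndex (lam : ℝ) (m : ℕ) :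
    Measurable fun x : ℝ => min ⌊x / lam⌋₊ m :=
  (Nat.measurable_floor.comp (measurable_id.div_const lam)).min measurable_const

theorem measurable_step {F : Type*} [MeasurableSpace F] (lam : ℝ) (m : ℕ) (f : ℕ → F) :
    Measurable fun x : ℝ => f (min ⌊x / lam⌋₊ m) :=
  (measurable_of_countable f).comp (measurable_cellIndex lam m)

theorem measurable_chiralityField (lam δ : ℝ) (u : ℕ → S2) :
    Measurable (chiralityField lam δ u) :=
  measurable_step lam _ (chirality δ u)

theorem integrable_of_bound {F : Type*} [NormedAddCommGroup F] {f : ℝ → F}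
    (hf : AEStronglyMeasurable f muI) (C : ℝ) (hC : ∀ x, ‖f x‖ ≤ C) : Integrable f muI :=
  Integrable.of_bound hf C (Eventually.of_forall hC)

theorem integrable_inner_of_bound {f φ : ℝ → E3} (hf : AEStronglyMeasurable f muI) (C : ℝ)
    (hC : ∀ᵐ x ∂muI, ‖f x‖ ≤ C) (hφ : Integrable φ muI) :
    Integrable (fun x => inner ℝ (f x) (φ x)) muI := by
  refine Integrable.mono' (hφ.norm.const_mul C) (hf.inner hφ.1) ?_
  filter_upwards [hC] with x hx
  exact (norm_inner_le_norm _ _).trans (mul_le_mul_of_nonneg_right hx (norm_nonneg _))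

/-- The values of a step function are among finitely many. -/
theorem exists_step_bound {F : Type*} [NormedAddCommGroup F] (lam : ℝ) (m : ℕ) (f : ℕ → F) :
    ∃ C, ∀ x : ℝ, ‖f (min ⌊x / lam⌋₊ m)‖ ≤ C :=
  ⟨∑ i ∈ Finset.range (m + 1), ‖f i‖, fun _ =>
    Finset.single_le_sum (f := fun i => ‖f i‖) (fun _ _ => norm_nonneg _)
      (Finset.mem_range.2 (Nat.lt_succ_of_le (min_le_right _ _)))⟩

/-- The integral of a step function is at most the sum of its values times the largest length
of a cell. -/
theorem integral_step_le {lam : ℝ} (hlam : 0 < lam) (m : ℕ) (hm : 1 ≤ lam * (m + 3))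
    (f : ℕ → ℝ) (hf : ∀ i, 0 ≤ f i) :
    ∫ x, f (min ⌊x / lam⌋₊ m) ∂muI ≤ 3 * lam * ∑ i ∈ Finset.range (m + 1), f i := by
  -- Cells before the last have length `lam`. The last one also carries the remainder up to 1, and
  -- `hm` keeps its length within `3 * lam`.
  have hset : ∀ i : ℕ, MeasurableSet (Set.Ico (lam * i) (lam * (i + 3))) :=
    fun i => measurableSet_Ico
  have hint : ∀ i : ℕ, Integrable
      ((Set.Ico (lam * i) (lam * (i + 3))).indicator fun _ => f i) muI :=
    fun i => (integrable_const (f i)).indicator (hset i)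
  calc ∫ x, f (min ⌊x / lam⌋₊ m) ∂muI
      ≤ ∫ x, ∑ i ∈ Finset.range (m + 1),
          (Set.Ico (lam * i) (lam * (i + 3))).indicator (fun _ => f i) x ∂muI := by
        apply integral_mono_ae
        · obtain ⟨C, hC⟩ := exists_step_bound lam m f
          exact integrable_of_bound (measurable_step lam m f).aestronglyMeasurable C hC
        · exact integrable_finsetSum _ fun i _ => hint i
        · filter_upwards [ae_restrict_mem measurableSet_Ioo] with x hx
          have hj : min ⌊x / lam⌋₊ m ∈ Finset.range (m + 1) :=
            Finset.mem_range.2 (Nat.lt_succ_of_le (min_le_right _ _))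
          refine le_trans ?_ (Finset.single_le_sum (f := fun i : ℕ =>
            (Set.Ico (lam * i) (lam * (i + 3))).indicator (fun _ => f i) x)
            (fun i _ => Set.indicator_nonneg (fun _ _ => hf i) x) hj)
          rw [Set.indicator_of_mem]
          have hx0 : 0 ≤ x / lam := div_nonneg hx.1.le hlam.le
          constructor
          · have h1 : ((min ⌊x / lam⌋₊ m : ℕ) : ℝ) ≤ x / lam :=
              le_trans (by exact_mod_cast min_le_left _ _) (Nat.floor_le hx0)
            rw [le_div_iff₀ hlam] at h1
            linarith
          · rcases le_total ⌊x / lam⌋₊ m with h | h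
            · rw [min_eq_left h]
              have := Nat.lt_floor_add_one (x / lam)
              rw [div_lt_iff₀ hlam] at this
              nlinarith
            · rw [min_eq_right h]
              exact lt_of_lt_of_le hx.2 hm
    _ = ∑ i ∈ Finset.range (m + 1), ∫ x,
          (Set.Ico (lam * i) (lam * (i + 3))).indicator (fun _ => f i) x ∂muI :=
        integral_finsetSum _ fun i _ => hint i
    _ ≤ ∑ i ∈ Finset.range (m + 1), 3 * lam * f i := by
        refine Finset.sum_le_sum fun i _ => ?_
        rw [integral_indicator_const _ (hset i), smul_eq_mul]
        refine mul_le_mul_of_nonneg_right ?_ (hf i)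
        refine le_trans (ENNReal.toReal_mono (by simp)
          (Measure.restrict_apply_le _ _)) ?_
        rw [Real.volume_Ico, ENNReal.toReal_ofReal (by nlinarith)]
        linarith
    _ = _ := by rw [Finset.mul_sum]

/-- The indices of the cells cover the unit interval. -/
theorem one_lt_mul_lastIndex_add_one {lam : ℝ} (hlam : 0 < lam) :
    1 < lam * (lastIndex lam + 1) := by
  have := Nat.lt_floor_add_one (1 / lam)
  rw [div_lt_iff₀ hlam] at this
  unfold lastIndex
  linarith

theorem mul_lastIndex_le_one {lam : ℝ} (hlam : 0 < lam) : lam * lastIndex lam ≤ 1 :=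
  ((le_lastIndex_iff hlam _).1 le_rfl).2

theorem two_le_lastIndex {lam : ℝ} (hlam : 0 < lam) (h : lam ≤ 1 / 2) : 2 ≤ lastIndex lam :=
  (le_lastIndex_iff hlam 2).2 ⟨by positivity, by push_cast; linarith⟩

/-- Second differences stop at N - 2 while chiralities run to N - 1, so the last chirality is
bounded as the second member of the pair at N - 2. -/
theorem norm_chiralityField_le {lam δ : ℝ} (hlam : 0 < lam) (hlam2 : lam ≤ 1 / 2) (hδ : 0 < δ)
    (hδ1 : δ ≤ 1) (u : ℕ → S2) (x : ℝ) :
    ‖chiralityField lam δ u x‖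
      ≤ 1 + ‖secondDiff δ u (min ⌊x / lam⌋₊ (lastIndex lam - 2))‖ / δ := by
  have h2 := two_le_lastIndex hlam hlam2
  unfold chiralityField
  rcases le_or_gt ⌊x / lam⌋₊ (lastIndex lam - 2) with h | h
  · rw [min_eq_left h, min_eq_left (by omega)]
    exact (norm_chirality_le hδ hδ1 u _).1
  · rw [min_eq_right h.le, min_eq_right (by omega)]
    have := (norm_chirality_le hδ hδ1 u (lastIndex lam - 2)).2
    rwa [show lastIndex lam - 2 + 1 = lastIndex lam - 1 by omega] at this

theorem integral_secondDiff_le {lam δ C : ℝ} (hlam : 0 < lam) (hlam2 : lam ≤ 1 / 2) (hδ : 0 < δ)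
    (u : ℕ → S2) (hE : chainEnergy lam δ u ≤ C * (Real.sqrt 2 * lam * (δ * Real.sqrt δ))) :
    ∫ x, ‖secondDiff δ u (min ⌊x / lam⌋₊ (lastIndex lam - 2))‖ / δ ∂muI
      ≤ Real.sqrt (18 * Real.sqrt 2 * C * (lam / Real.sqrt δ)) := by
  have h2 := two_le_lastIndex hlam hlam2
  have hN := mul_lastIndex_le_one hlam
  obtain ⟨m, hm⟩ : ∃ m, lastIndex lam = m + 2 := ⟨_, (Nat.sub_add_cancel h2).symm⟩
  have hm2 : lastIndex lam - 2 = m := by omega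
  have hN1 := one_lt_mul_lastIndex_add_one hlam
  rw [hm] at hN1 hN
  push_cast at hN1 hN
  rw [hm2, integral_div]
  have h3 := integral_step_le hlam m (by linarith) (fun i => ‖secondDiff δ u i‖)
    (fun i => norm_nonneg _)
  have hE2 : lam * ∑ i ∈ Finset.range (m + 1), ‖secondDiff δ u i‖ ^ 2
      ≤ 2 * (C * (Real.sqrt 2 * lam * (δ * Real.sqrt δ))) := by
    rw [chainEnergy, innerIndices, hm, ← Finset.mul_sum] at hE
    simp only [secondDiff]
    have : m + 2 - 1 = m + 1 := by omega
    rw [this] at hE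
    linarith
  -- Cauchy-Schwarz costs the number m + 1 of cells, which one factor `lam` absorbs.
  have h4 := sq_sum_le_card_mul_sum_sq (s := Finset.range (m + 1))
    (f := fun i => ‖secondDiff δ u i‖)
  rw [Finset.card_range] at h4
  push_cast at h4
  apply Real.le_sqrt_of_sq_le
  set S := ∑ i ∈ Finset.range (m + 1), ‖secondDiff δ u i‖
  set Q := ∑ i ∈ Finset.range (m + 1), ‖secondDiff δ u i‖ ^ 2
  set J := ∫ x, ‖secondDiff δ u (min ⌊x / lam⌋₊ m)‖ ∂muI
  have hJ : 0 ≤ J := integral_nonneg fun x => norm_nonneg _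
  have hQ : 0 ≤ Q := Finset.sum_nonneg fun i _ => by positivity
  have hs : 0 < Real.sqrt δ := Real.sqrt_pos.2 hδ
  have hss : Real.sqrt δ ^ 2 = δ := Real.sq_sqrt hδ.le
  have h5 : J ^ 2 ≤ 9 * (lam * Q) :=
    calc J ^ 2 ≤ (3 * lam * S) ^ 2 := pow_le_pow_left₀ hJ h3 2
      _ = 9 * lam ^ 2 * S ^ 2 := by ring
      _ ≤ 9 * lam ^ 2 * ((m + 1) * Q) := by gcongr
      _ = 9 * (lam * Q) * (lam * (m + 1)) := by ring
      _ ≤ 9 * (lam * Q) * 1 := by gcongr; nlinarith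
      _ = 9 * (lam * Q) := mul_one _
  have h6 : J ^ 2 ≤ 18 * (C * (Real.sqrt 2 * lam * (δ * Real.sqrt δ))) := by linarith
  have h7 : 18 * Real.sqrt 2 * C * (lam / Real.sqrt δ)
      = 18 * (C * (Real.sqrt 2 * lam * (δ * Real.sqrt δ))) / δ ^ 2 := by
    rw [eq_div_iff (by positivity), mul_assoc, div_mul_eq_mul_div, mul_div_assoc',
      div_eq_iff hs.ne']
    have : δ ^ 2 = δ * Real.sqrt δ ^ 2 := by rw [hss]; ring
    rw [this]
    ring
  rw [div_pow, h7]
  gcongr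

/-- Chains of low energy have chirality of essentially at most unit length. -/
theorem integral_inner_chiralityField_le {lam δ C : ℝ} (hlam : 0 < lam) (hlam2 : lam ≤ 1 / 2)
    (hδ : 0 < δ) (hδ1 : δ ≤ 1) (u : ℕ → S2)
    (hE : chainEnergy lam δ u ≤ C * (Real.sqrt 2 * lam * (δ * Real.sqrt δ)))
    (φ : ℝ → E3) (hφ : AEStronglyMeasurable φ muI) (hφ1 : ∀ᵐ x ∂muI, ‖φ x‖ ≤ 1) :
    ∫ x, inner ℝ (chiralityField lam δ u x) (φ x) ∂muI
      ≤ ∫ x, ‖φ x‖ ∂muI + Real.sqrt (18 * Real.sqrt 2 * C * (lam / Real.sqrt δ)) := by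
  refine le_trans ?_ (add_le_add_right (integral_secondDiff_le hlam hlam2 hδ u hE) _)
  have hφi : Integrable φ muI := Integrable.of_bound hφ 1 hφ1
  have hVi : Integrable
      (fun x => ‖secondDiff δ u (min ⌊x / lam⌋₊ (lastIndex lam - 2))‖ / δ) muI := by
    obtain ⟨C, hC⟩ := exists_step_bound lam (lastIndex lam - 2)
      (fun i => ‖secondDiff δ u i‖ / δ)
    exact integrable_of_bound
      (measurable_step lam _ (fun i => ‖secondDiff δ u i‖ / δ)).aestronglyMeasurable C hC
  rw [← integral_add hφi.norm hVi]
  obtain ⟨K, hK⟩ := exists_step_bound lam (lastIndex lam - 1) (chirality δ u)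
  refine integral_mono_ae
    (integrable_inner_of_bound (measurable_chiralityField lam δ u).aestronglyMeasurable K
      (Eventually.of_forall hK) hφi) (hφi.norm.add hVi) ?_
  filter_upwards [hφ1] with x hx
  have h1 := norm_chiralityField_le hlam hlam2 hδ hδ1 u x
  have h2 := real_inner_le_norm (chiralityField lam δ u x) (φ x)
  have h3 : 0 ≤ ‖secondDiff δ u (min ⌊x / lam⌋₊ (lastIndex lam - 2))‖ / δ := by positivity
  have h4 := norm_nonneg (φ x)
  nlinarith

/-! ### Sublevel sets and the liminf inequality -/

theorem rpow_three_halves {δ : ℝ} (hδ : 0 < δ) : δ ^ (3 / 2 : ℝ) = δ * Real.sqrt δ := by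
  rw [show (3 / 2 : ℝ) = 1 + 1 / 2 by norm_num, Real.rpow_add hδ, Real.rpow_one,
    Real.sqrt_eq_rpow]

/-- The sublevel sets of the rescaled functional, in terms of spin chains. -/
theorem exists_chain_of_scaledHslR_le {R lam δ : ℝ} {C : ℝ} (hlam : 0 < lam) (hδ : 0 < δ)
    {z : L1I} (h : scaledHslR R lam δ z < ENNReal.ofReal C) :
    ∃ u : ℕ → S2, z =ᵐ[muI] chiralityField lam δ u ∧
      chainEnergy lam δ u ≤ C * (Real.sqrt 2 * lam * (δ * Real.sqrt δ)) := by
  have hD : 0 < Real.sqrt 2 * lam * (δ * Real.sqrt δ) := by positivity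
  rw [scaledHslR, rpow_three_halves hδ, ENNReal.div_lt_iff (by simp [hD]) (by simp), HslR] at h
  split_ifs at h with hR
  · rw [← ENNReal.ofReal_mul' hD.le] at h
    unfold Hsl at h
    simp only [iInf_lt_iff] at h
    obtain ⟨u, -, hz, hu⟩ := h
    exact ⟨u, hz, (ENNReal.ofReal_lt_ofReal_iff'.1 hu).1.le⟩
  · exact absurd h (by simp)

/-- Testing with z₀/|z₀| on A = {|z₀| > 1} gives in the limit that the integral of |z₀| over A is at
most the measure of A, so A is null. -/
theorem norm_le_one_of_weakStarTendsto {R : ℝ} {lam δ : ℕ → ℝ}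
    (hlam_pos : ∀ n, 0 < lam n) (hlam : Tendsto lam atTop (𝓝 0))
    (hδ_pos : ∀ n, 0 < δ n) (hδ : Tendsto δ atTop (𝓝 0))
    (hscale : Tendsto (fun n => lam n / Real.sqrt (δ n)) atTop (𝓝 0))
    {z : ℕ → L1I} {z₀ : L1I} (hz : WeakStarTendsto z z₀) {C : ℝ}
    (hC : ∃ᶠ n in atTop, scaledHslR R (lam n) (δ n) (z n) < ENNReal.ofReal C) :
    ∀ᵐ x ∂muI, ‖z₀ x‖ ≤ 1 := by
  have hsm : StronglyMeasurable z₀ := Lp.stronglyMeasurable z₀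
  set A : Set ℝ := {x | 1 < ‖z₀ x‖} with hA
  have hAm : MeasurableSet A := measurableSet_lt measurable_const hsm.norm.measurable
  set ψ : ℝ → E3 := A.indicator fun x => ‖z₀ x‖⁻¹ • z₀ x with hψ
  have hψm : AEStronglyMeasurable ψ muI :=
    ((hsm.norm.measurable.inv.stronglyMeasurable.smul hsm).indicator hAm).aestronglyMeasurable
  have hψnorm : ∀ x, ‖ψ x‖ = A.indicator 1 x := by
    intro x
    by_cases hx : x ∈ A
    · have : ‖z₀ x‖ ≠ 0 := (lt_trans one_pos hx).ne'
      simp [hψ, Set.indicator_of_mem hx, norm_smul, this]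
    · simp [hψ, Set.indicator_of_notMem hx]
  have hψ1 : ∀ x, ‖ψ x‖ ≤ 1 := by
    intro x
    rw [hψnorm]
    exact Set.indicator_le_self' (fun _ _ => zero_le_one) x
  have hψint : Integrable ψ muI := integrable_of_bound hψm 1 hψ1
  have hψL : MemLp ψ 1 muI := memLp_one_iff_integrable.2 hψint
  have hinner : ∀ x, inner ℝ (z₀ x) (ψ x) = A.indicator (fun x => ‖z₀ x‖) x := by
    intro x
    by_cases hx : x ∈ A
    · have : ‖z₀ x‖ ≠ 0 := (lt_trans one_pos hx).ne'
      rw [hψ, Set.indicator_of_mem hx, Set.indicator_of_mem hx, inner_smul_right,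
        real_inner_self_eq_norm_sq]
      field_simp
    · simp [hψ, Set.indicator_of_notMem hx]
  have hlim := hz.2.2 (hψL.toLp ψ)
  have hcongr : ∀ w : L1I, ∫ x, inner ℝ (w x) ((MemLp.toLp ψ hψL : L1I) x) ∂muI
      = ∫ x, inner ℝ (w x) (ψ x) ∂muI := fun w => by
    apply integral_congr_ae
    filter_upwards [MemLp.coeFn_toLp hψL] with x hx
    rw [hx]
  simp only [hcongr] at hlim
  have herr : Tendsto (fun n => ∫ x, ‖ψ x‖ ∂muI
      + Real.sqrt (18 * Real.sqrt 2 * C * (lam n / Real.sqrt (δ n)))) atTop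
      (𝓝 (∫ x, ‖ψ x‖ ∂muI)) := by
    have := (hscale.const_mul (18 * Real.sqrt 2 * C)).sqrt.const_add (∫ x, ‖ψ x‖ ∂muI)
    simpa using this
  have hle : ∫ x, inner ℝ (z₀ x) (ψ x) ∂muI ≤ ∫ x, ‖ψ x‖ ∂muI := by
    -- The pairings converge along the whole sequence, so an inequality for infinitely many n passes
    -- to the limit.
    refine le_of_tendsto_of_tendsto_of_frequently hlim herr ?_
    refine (hC.and_eventually ((hlam.eventually (ge_mem_nhds (by norm_num : (0:ℝ) < 1 / 2))).and
      (hδ.eventually (ge_mem_nhds one_pos)))).mono fun n hn => ?_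
    obtain ⟨hn, hn2, hn3⟩ := hn
    obtain ⟨u, hu, hE⟩ := exists_chain_of_scaledHslR_le (hlam_pos n) (hδ_pos n) hn
    refine le_trans (le_of_eq ?_) (integral_inner_chiralityField_le (hlam_pos n) hn2 (hδ_pos n)
      hn3 u hE ψ hψm (Eventually.of_forall hψ1))
    apply integral_congr_ae
    filter_upwards [hu] with x hx
    rw [hx]
  have hi1 : Integrable (fun x => inner ℝ (z₀ x) (ψ x) - ‖ψ x‖) muI := by
    refine Integrable.sub ?_ hψint.norm
    simp only [hinner]
    exact (L1.integrable_coeFn z₀).norm.indicator hAm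
  have hnn : ∀ x, 0 ≤ inner ℝ (z₀ x) (ψ x) - ‖ψ x‖ := by
    intro x
    rw [hinner, hψnorm]
    by_cases hx : x ∈ A
    · rw [Set.indicator_of_mem hx, Set.indicator_of_mem hx]
      exact sub_nonneg.2 (le_of_lt hx)
    · simp [Set.indicator_of_notMem hx]
  have hzero : ∫ x, (inner ℝ (z₀ x) (ψ x) - ‖ψ x‖) ∂muI = 0 := by
    refine le_antisymm ?_ (integral_nonneg hnn)
    rw [integral_sub _ hψint.norm]
    · linarith
    · simp only [hinner]
      exact (L1.integrable_coeFn z₀).norm.indicator hAm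
  rw [integral_eq_zero_iff_of_nonneg hnn hi1] at hzero
  filter_upwards [hzero] with x hx
  by_contra hcon
  have hxA : x ∈ A := not_le.1 hcon
  simp only [hinner, hψnorm, Set.indicator_of_mem hxA, Pi.zero_apply, Pi.one_apply] at hx
  have : 1 < ‖z₀ x‖ := hxA
  linarith

theorem limitFunctional_le_liminf {R : ℝ} {lam δ : ℕ → ℝ}
    (hlam_pos : ∀ n, 0 < lam n) (hlam : Tendsto lam atTop (𝓝 0))
    (hδ_pos : ∀ n, 0 < δ n) (hδ : Tendsto δ atTop (𝓝 0))
    (hscale : Tendsto (fun n => lam n / Real.sqrt (δ n)) atTop (𝓝 0))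
    {z : ℕ → L1I} {z₀ : L1I} (hz : WeakStarTendsto z z₀) :
    limitFunctional z₀ ≤ liminf (fun n => scaledHslR R (lam n) (δ n) (z n)) atTop := by
  by_cases h1 : ∀ᵐ x ∂muI, z₀ x ∈ Metric.closedBall (0 : E3) 1
  · rw [limitFunctional, if_pos h1]
    exact zero_le
  -- A finite liminf would put infinitely many energies below a common level, forcing z₀ into the
  -- ball.
  · refine le_of_forall_lt fun c hc => ?_
    by_contra hcon
    rw [not_lt] at hcon
    have hct : c ≠ ⊤ := hc.ne_top
    have h2 : liminf (fun n => scaledHslR R (lam n) (δ n) (z n)) atTop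
        < ENNReal.ofReal (c.toReal + 1) := by
      refine lt_of_le_of_lt hcon ?_
      rw [ENNReal.lt_ofReal_iff_toReal_lt hct]
      linarith
    have h3 := frequently_lt_of_liminf_lt (by isBoundedDefault) h2
    have h4 := norm_le_one_of_weakStarTendsto hlam_pos hlam hδ_pos hδ hscale hz h3
    exact h1 (h4.mono fun x hx => by simpa using hx)

/-! ### Chains adapted to a curve on the sphere -/

theorem exists_unit_orthogonal (p q : E3) :
    ∃ v : E3, ‖v‖ = 1 ∧ inner ℝ p v = 0 ∧ inner ℝ q v = 0 := by
  have h : LinearMap.ker ((innerₛₗ ℝ p).prod (innerₛₗ ℝ q)) ≠ ⊥ := by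
    apply LinearMap.ker_ne_bot_of_finrank_lt
    simp
  obtain ⟨w, hw, hw0⟩ := Submodule.exists_mem_ne_zero_of_ne_bot h
  have hw' : inner ℝ p w = 0 ∧ inner ℝ q w = 0 := by simpa using hw
  refine ⟨‖w‖⁻¹ • w, ?_, ?_, ?_⟩
  · rw [norm_smul, norm_inv, norm_norm, inv_mul_cancel₀ (norm_ne_zero_iff.2 hw0)]
  · rw [inner_smul_right, hw'.1, mul_zero]
  · rw [inner_smul_right, hw'.2, mul_zero]

theorem cross_cross_right (a b c : E3) :
    cross a (cross b c) = inner ℝ a c • b - inner ℝ a b • c := by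
  ext i
  fin_cases i <;>
    simp [cross, crossProduct, PiLp.inner_apply, Fin.sum_univ_three] <;> ring

/-- Parseval in the plane orthogonal to the unit vector `w`. -/
theorem norm_sq_eq_of_orthogonal {e w D : E3} (he : ‖e‖ = 1) (hw : ‖w‖ = 1)
    (hew : inner ℝ w e = 0) (hwD : inner ℝ w D = 0) :
    ‖D‖ ^ 2 = inner ℝ e D ^ 2 + inner ℝ w (cross e D) ^ 2 := by
  have h1 := norm_cross_sq e D
  have h2 := norm_cross_sq w (cross e D)
  rw [cross_cross_right, hew, hwD, hw] at h2
  rw [he] at h1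
  simp only [zero_smul, sub_zero, norm_zero] at h2
  linarith

/-- Parseval for a × b, which lies in the plane orthogonal to b: its components along e and b × e
are, up to sign, (e, a × b) and (e, a). -/
theorem inner_sq_add_inner_sq_of_cross {e a b : E3} {δ : ℝ} (he : ‖e‖ = 1) (ha : ‖a‖ = 1)
    (hb : ‖b‖ = 1) (hbe : inner ℝ b e = 0) (hab : inner ℝ a b = 1 - δ) :
    inner ℝ e (cross a b) ^ 2 + inner ℝ e a ^ 2 = δ * (2 - δ) := by
  have h1 := norm_sq_eq_of_orthogonal he hb hbe (inner_cross_right_self a b)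
  rw [cross_cross_right, inner_sub_right, inner_smul_right, inner_smul_right,
    real_inner_self_eq_norm_sq, hb, norm_cross_sq, ha, hb, hab, real_inner_comm b e, hbe] at h1
  nlinarith

/-- In the plane orthogonal to e', the projection p of u and q = e' × u are orthogonal with common
squared length 1 - a². The coefficient x is fixed by the prescribed scalar product, y by unit
length, and the root y ≥ 0 gives the orientation. The root exists because a² ≤ δ/4 implies (1 - δ)²
≤ 1 - a². -/
theorem exists_next_spin {e e' u : E3} {δ : ℝ} (hδ : 0 < δ) (hδ2 : δ ≤ 1 / 2)
    (he' : ‖e'‖ = 1) (hu : ‖u‖ = 1) (hue : inner ℝ u e = 0)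
    (hee : ‖e' - e‖ ^ 2 ≤ δ / 4) :
    ∃ u' : E3, ‖u'‖ = 1 ∧ inner ℝ u' e' = 0 ∧ inner ℝ u u' = 1 - δ ∧
      0 ≤ inner ℝ e' (cross u u') := by
  set a := inner ℝ u e' with ha
  have ha1 : a = inner ℝ u (e' - e) := by rw [inner_sub_right, hue, sub_zero]
  have ha2 : a ^ 2 ≤ δ / 4 := by
    refine le_trans ?_ hee
    rw [ha1]
    apply sq_le_sq.2
    rw [abs_norm]
    simpa [hu] using abs_real_inner_le_norm u (e' - e)
  have hs : 0 < 1 - a ^ 2 := by linarith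
  have hue' : inner ℝ e' u = a := real_inner_comm _ _
  have hee' : inner ℝ e' e' = (1 : ℝ) := by rw [real_inner_self_eq_norm_sq, he', one_pow]
  have huu : inner ℝ u u = (1 : ℝ) := by rw [real_inner_self_eq_norm_sq, hu, one_pow]
  set p := u - a • e' with hp
  set q := cross e' u with hq
  set x := (1 - δ) / (1 - a ^ 2) with hx
  set y := Real.sqrt (1 / (1 - a ^ 2) - x ^ 2) with hy
  have hxs : x * (1 - a ^ 2) = 1 - δ := div_mul_cancel₀ _ hs.ne'
  have hrad : 0 ≤ 1 / (1 - a ^ 2) - x ^ 2 := by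
    rw [hx, div_pow, sub_nonneg, div_le_div_iff₀ (by positivity) hs]
    nlinarith
  have hy2 : (x ^ 2 + y ^ 2) * (1 - a ^ 2) = 1 := by
    rw [hy, Real.sq_sqrt hrad]
    field_simp
    ring
  have hpp : inner ℝ p p = 1 - a ^ 2 := by
    rw [hp, inner_sub_left, inner_sub_right, inner_sub_right, inner_smul_left, inner_smul_left,
      inner_smul_right, inner_smul_right, hue', hee', huu, ← ha]
    simp
    ring
  have hqq : inner ℝ q q = 1 - a ^ 2 := by
    rw [hq, inner_cross_cross, hue', hee', huu, ← ha]
    ring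
  have hup : inner ℝ u p = 1 - a ^ 2 := by
    rw [hp, inner_sub_right, inner_smul_right, huu, ← ha]
    ring
  have huq : inner ℝ u q = 0 := inner_cross_right_self _ _
  have heq : inner ℝ e' q = 0 := inner_cross_left_self _ _
  have hep : inner ℝ e' p = 0 := by
    rw [hp, inner_sub_right, inner_smul_right, hue', hee']
    ring
  have hpq : inner ℝ p q = 0 := by
    rw [hp, inner_sub_left, inner_smul_left, huq, heq]
    simp
  have heup : inner ℝ e' (cross u p) = 0 := by
    rw [inner_cross_rotate, hp, inner_sub_left, inner_smul_left, ← hq, huq, heq]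
    simp
  refine ⟨x • p + y • q, ?_, ?_, ?_, ?_⟩
  · rw [← sq_eq_sq₀ (norm_nonneg _) zero_le_one, ← real_inner_self_eq_norm_sq, inner_add_left,
      inner_add_right, inner_add_right, inner_smul_left, inner_smul_left, inner_smul_left,
      inner_smul_left, inner_smul_right, inner_smul_right, inner_smul_right, inner_smul_right,
      hpp, hqq, real_inner_comm p q, hpq]
    simp
    linarith
  · rw [real_inner_comm, inner_add_right, inner_smul_right, inner_smul_right, hep, heq]
    ring
  · rw [inner_add_right, inner_smul_right, inner_smul_right, hup, huq]
    linarith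
  · rw [cross_add_right, cross_smul_right, cross_smul_right, inner_add_right, inner_smul_right,
      inner_smul_right, heup, inner_cross_rotate e' u q, ← hq, hqq]
    have : 0 ≤ y := Real.sqrt_nonneg _
    have := mul_nonneg this hs.le
    linarith

/-- The chain `u` turns by the angle `arccos (1 - δ)` at each step, with spins orthogonal to the
directions `e`. -/
structure IsAdapted (δ : ℝ) (e : ℕ → E3) (u : ℕ → S2) : Prop where
  orthogonal : ∀ i, inner ℝ (u i : E3) (e i) = 0
  angle : ∀ i, inner ℝ (u i : E3) (u (i + 1) : E3) = 1 - δ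
  forward : ∀ i, 0 ≤ inner ℝ (e (i + 1)) (cross (u i : E3) (u (i + 1) : E3))

theorem exists_isAdapted {δ : ℝ} (hδ : 0 < δ) (hδ2 : δ ≤ 1 / 2) {e : ℕ → E3}
    (he : ∀ i, ‖e i‖ = 1) (hee : ∀ i, ‖e (i + 1) - e i‖ ^ 2 ≤ δ / 4) :
    ∃ u : ℕ → S2, IsAdapted δ e u := by
  have hstep : ∀ (i : ℕ) (p : {u : S2 // inner ℝ (u : E3) (e i) = 0}),
      ∃ q : {u : S2 // inner ℝ (u : E3) (e (i + 1)) = 0},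
        inner ℝ (p.1 : E3) (q.1 : E3) = 1 - δ ∧
          0 ≤ inner ℝ (e (i + 1)) (cross (p.1 : E3) (q.1 : E3)) := by
    intro i p
    obtain ⟨v, h1, h2, h3, h4⟩ := exists_next_spin hδ hδ2 (he (i + 1)) (norm_S2 p.1) p.2 (hee i)
    exact ⟨⟨⟨v, mem_sphere_zero_iff_norm.2 h1⟩, h2⟩, h3, h4⟩
  choose next hnext using hstep
  obtain ⟨v, hv, hve, -⟩ := exists_unit_orthogonal (e 0) (e 0)
  let w : ∀ i, {u : S2 // inner ℝ (u : E3) (e i) = 0} := fun i =>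
    Nat.rec (motive := fun i => {u : S2 // inner ℝ (u : E3) (e i) = 0})
      ⟨⟨v, mem_sphere_zero_iff_norm.2 hv⟩, by rw [real_inner_comm]; exact hve⟩ next i
  exact ⟨fun i => (w i).1, fun i => (w i).2, fun i => (hnext i (w i)).1,
    fun i => (hnext i (w i)).2⟩

theorem abs_inner_le_of_orthogonal {e e' a : E3} (ha : ‖a‖ = 1) (hae : inner ℝ a e = 0) :
    |inner ℝ e' a| ≤ ‖e' - e‖ := by
  have : inner ℝ e' a = inner ℝ (e' - e) a := by
    rw [inner_sub_left, real_inner_comm a e, hae, sub_zero]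
  rw [this]
  simpa [ha] using abs_real_inner_le_norm (e' - e) a

/-- Subtracting the two Pythagorean relations gives (Y - X)(X + Y) = -(α + γ)(γ - α). Here |γ - α| ≤
√δ ≤ X + Y, so the quotient is harmless and the factor α + γ survives. -/
theorem sq_sub_le_sq_add {X Y Y' α β γ δ η ρ : ℝ} (hδ : 0 < δ) (hδ2 : δ ≤ 1 / 2)
    (hη : η ^ 2 ≤ δ / 4) (hX0 : 0 ≤ X) (hY0 : 0 ≤ Y') (hρ : ρ ^ 2 = δ * (2 - δ))
    (hX : X ^ 2 + α ^ 2 = δ * (2 - δ)) (hY : δ * (2 - δ) = Y ^ 2 + γ ^ 2)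
    (hY2 : Y' ^ 2 + β ^ 2 = δ * (2 - δ)) (hY1 : Y' - η * ρ ≤ Y) (hα2 : α ^ 2 ≤ η ^ 2)
    (hβ2 : β ^ 2 ≤ η ^ 2) (hαγ : (γ - α) ^ 2 ≤ δ) :
    (Y - X) ^ 2 ≤ (α + γ) ^ 2 := by
  -- The orientation of the chain gives a sign only to Y', taken along the next direction; Y
  -- inherits it because Y' dominates η ρ.
  have hYpos : 0 ≤ Y := by
    have h1 : η * ρ ≤ Y' := by
      apply abs_le_of_sq_le_sq' _ hY0 |>.2
      rw [mul_pow, hρ]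
      nlinarith
    linarith
  have hXδ : δ ≤ (X + Y) ^ 2 := by nlinarith
  have hdiff : (Y - X) ^ 2 * (X + Y) ^ 2 = (α + γ) ^ 2 * (γ - α) ^ 2 := by
    have : (Y - X) * (X + Y) = -((α + γ) * (γ - α)) := by linarith
    rw [← mul_pow, this]
    ring
  have h1 : (Y - X) ^ 2 * (X + Y) ^ 2 ≤ (α + γ) ^ 2 * (X + Y) ^ 2 := by
    rw [hdiff]
    exact mul_le_mul_of_nonneg_left (hαγ.trans hXδ) (sq_nonneg _)
  exact le_of_mul_le_mul_right h1 (lt_of_lt_of_le hδ hXδ)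

/-- The jump of cross products is orthogonal to b. Its component along e1 is Y - X and its component
along b × e1 is, up to sign, the sum α + γ, so both are controlled by that sum. -/
theorem norm_cross_sub_cross_sq_le {a b c e1 e2 : E3} {δ η : ℝ} (hδ : 0 < δ) (hδ2 : δ ≤ 1 / 2)
    (hη : η ^ 2 ≤ δ / 4) (ha : ‖a‖ = 1) (hb : ‖b‖ = 1) (hc : ‖c‖ = 1)
    (he1 : ‖e1‖ = 1) (he2 : ‖e2‖ = 1) (hab : inner ℝ a b = 1 - δ) (hbc : inner ℝ b c = 1 - δ)
    (hbe : inner ℝ b e1 = 0) (hce : inner ℝ c e2 = 0)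
    (hX0 : 0 ≤ inner ℝ e1 (cross a b)) (hY0 : 0 ≤ inner ℝ e2 (cross b c))
    (hα : |inner ℝ e1 a| ≤ η) (hγ : |inner ℝ e1 c| ≤ η) (hβ : |inner ℝ e2 b| ≤ η)
    (hdir : ‖e2 - e1‖ ≤ η) :
    ‖cross b c - cross a b‖ ^ 2 ≤ 2 * (inner ℝ e1 a + inner ℝ e1 c) ^ 2 := by
  have hX := inner_sq_add_inner_sq_of_cross he1 ha hb hbe hab
  have hY2 := inner_sq_add_inner_sq_of_cross he2 hb hc hce hbc
  have hDc : ‖cross b c‖ ^ 2 = δ * (2 - δ) := by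
    rw [norm_cross_sq, hb, hc, hbc]
    ring
  have hbD1 : inner ℝ b (cross e1 (cross a b)) = -inner ℝ e1 a := by
    rw [cross_cross_right, inner_sub_right, inner_smul_right, inner_smul_right,
      real_inner_self_eq_norm_sq, hb, real_inner_comm b e1, hbe]
    ring
  have hbD2 : inner ℝ b (cross e1 (cross b c)) = inner ℝ e1 c := by
    rw [cross_cross_right, inner_sub_right, inner_smul_right, inner_smul_right,
      real_inner_self_eq_norm_sq, hb, real_inner_comm b e1, hbe]
    ring
  have hY := norm_sq_eq_of_orthogonal he1 hb hbe (inner_cross_left_self b c)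
  rw [hDc, hbD2] at hY
  have hcs : cross e1 (cross b c - cross a b)
      = cross e1 (cross b c) - cross e1 (cross a b) := by
    rw [sub_eq_add_neg, cross_add_right, ← neg_one_smul ℝ (cross a b), cross_smul_right]
    simp [sub_eq_add_neg]
  have hD := norm_sq_eq_of_orthogonal (D := cross b c - cross a b) he1 hb hbe (by
    rw [inner_sub_right, inner_cross_left_self, inner_cross_right_self, sub_zero])
  rw [hcs, inner_sub_right, inner_sub_right, hbD1, hbD2] at hD
  rw [hD]
  have hY1 : inner ℝ e2 (cross b c) - η * ‖cross b c‖ ≤ inner ℝ e1 (cross b c) := by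
    have h1 : inner ℝ (e2 - e1) (cross b c) ≤ η * ‖cross b c‖ :=
      (real_inner_le_norm _ _).trans (mul_le_mul_of_nonneg_right hdir (norm_nonneg _))
    rw [inner_sub_left] at h1
    linarith
  have hα2 := sq_le_sq' (abs_le.1 hα).1 (abs_le.1 hα).2
  have hβ2 := sq_le_sq' (abs_le.1 hβ).1 (abs_le.1 hβ).2
  have hαγ : (inner ℝ e1 c - inner ℝ e1 a) ^ 2 ≤ δ := by
    have h1 : |inner ℝ e1 c - inner ℝ e1 a| ≤ 2 * η :=
      (abs_sub _ _).trans (by linarith)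
    rw [← sq_abs]
    refine (pow_le_pow_left₀ (abs_nonneg _) h1 2).trans ?_
    linarith
  have := sq_sub_le_sq_add hδ hδ2 hη hX0 hY0 hDc hX hY hY2 hY1 hα2 hβ2 hαγ
  linarith

/-! ### Chirality and energy of adapted chains -/

namespace IsAdapted

variable {δ η : ℝ} {e : ℕ → E3} {u : ℕ → S2}

/-- The chirality has squared length 1 - δ/2. Its component t along e lies in [0, 1], so t ≥ t², and
t² is computed by Parseval. -/
theorem norm_chirality_sub_sq_le (h : IsAdapted δ e u) (hδ : 0 < δ) (he : ∀ i, ‖e i‖ = 1)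
    (hee : ∀ i, ‖e (i + 1) - e i‖ ≤ η) (i : ℕ) :
    ‖chirality δ u i - e (i + 1)‖ ^ 2 ≤ δ + η ^ 2 / δ := by
  have h1 := inner_sq_add_inner_sq_of_cross (he (i + 1)) (norm_S2 (u i)) (norm_S2 (u (i + 1)))
    (h.orthogonal (i + 1)) (h.angle i)
  have h2 : inner ℝ (e (i + 1)) (u i : E3) ^ 2 ≤ η ^ 2 := by
    rw [← sq_abs]
    exact pow_le_pow_left₀ (abs_nonneg _)
      ((abs_inner_le_of_orthogonal (norm_S2 (u i)) (h.orthogonal i)).trans (hee i)) 2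
  have h3 : 0 ≤ inner ℝ (e (i + 1)) (chirality δ u i) := by
    rw [chirality, inner_smul_right]
    exact mul_nonneg (by positivity) (h.forward i)
  have h4 : inner ℝ (e (i + 1)) (chirality δ u i) ^ 2
      = inner ℝ (e (i + 1)) (cross (u i : E3) (u (i + 1))) ^ 2 / (2 * δ) := by
    rw [chirality, inner_smul_right, mul_pow, inv_pow, Real.sq_sqrt (by positivity)]
    ring
  have h5 : ‖chirality δ u i‖ ^ 2 = 1 - δ / 2 := by
    rw [norm_chirality_sq hδ, h.angle i]
    field_simp
    ring
  have h6 : 1 - δ / 2 - η ^ 2 / (2 * δ) ≤ inner ℝ (e (i + 1)) (chirality δ u i) ^ 2 := by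
    rw [h4, le_div_iff₀ (by positivity)]
    have : (1 - δ / 2 - η ^ 2 / (2 * δ)) * (2 * δ) = δ * (2 - δ) - η ^ 2 := by
      field_simp
    rw [this]
    linarith
  have h7 : inner ℝ (e (i + 1)) (chirality δ u i) ≤ 1 := by
    refine (real_inner_le_norm _ _).trans ?_
    rw [he, one_mul, ← abs_norm, ← sq_le_one_iff_abs_le_one, h5]
    linarith
  rw [norm_sub_sq_real, h5, he, real_inner_comm]
  have h8 : η ^ 2 / δ = 2 * (η ^ 2 / (2 * δ)) := by
    field_simp
  rw [h8]
  nlinarith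

theorem norm_secondDiff_sq_le (h : IsAdapted δ e u) (hδ : 0 < δ) (hδ2 : δ ≤ 1 / 2)
    (he : ∀ i, ‖e i‖ = 1) (hee : ∀ i, ‖e (i + 1) - e i‖ ≤ η) (hη : η ^ 2 ≤ δ / 4) (i : ℕ) :
    ‖secondDiff δ u i‖ ^ 2
      ≤ 2 * (inner ℝ (e (i + 1)) (u i : E3) + inner ℝ (e (i + 1)) (u (i + 2) : E3)) ^ 2 := by
  have ha := norm_S2 (u i)
  have hb := norm_S2 (u (i + 1))
  have hc := norm_S2 (u (i + 2))
  have hab := h.angle i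
  have hbc : inner ℝ (u (i + 1) : E3) (u (i + 2) : E3) = 1 - δ := h.angle (i + 1)
  have hbe := h.orthogonal (i + 1)
  have hce : inner ℝ (u (i + 2) : E3) (e (i + 2)) = 0 := h.orthogonal (i + 2)
  have hX0 := h.forward i
  have hY0 : 0 ≤ inner ℝ (e (i + 2)) (cross (u (i + 1) : E3) (u (i + 2))) := h.forward (i + 1)
  have hα := (abs_inner_le_of_orthogonal (e' := e (i + 1)) ha (h.orthogonal i)).trans (hee i)
  have hγ : |inner ℝ (e (i + 1)) (u (i + 2) : E3)| ≤ η := by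
    refine (abs_inner_le_of_orthogonal hc hce).trans ?_
    rw [norm_sub_rev]
    exact hee (i + 1)
  have hβ : |inner ℝ (e (i + 2)) (u (i + 1) : E3)| ≤ η :=
    (abs_inner_le_of_orthogonal hb hbe).trans (hee (i + 1))
  have hdir : ‖e (i + 2) - e (i + 1)‖ ≤ η := hee (i + 1)
  have he1 := he (i + 1)
  have he2 := he (i + 2)
  rw [secondDiff, norm_second_difference_sq _ _ _ hb, hab, hbc,
    show 1 - δ + (1 - δ) - 2 * (1 - δ) = 0 by ring, zero_pow two_ne_zero, add_zero]
  exact norm_cross_sub_cross_sq_le hδ hδ2 hη ha hb hc he1 he2 hab hbc hbe hce hX0 hY0 hα hγ hβ hdir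

end IsAdapted

/-- A curve on the unit sphere of class `C^{1,1}`, in terms of its first and second differences. -/
structure IsSphereCurve (L : ℝ) (e : ℝ → E3) : Prop where
  norm_eq : ∀ t, ‖e t‖ = 1
  lipschitz : ∀ t s, ‖e t - e s‖ ≤ L * |t - s|
  second : ∀ t s, ‖e (t + 2 * s) - (2 : ℝ) • e (t + s) + e t‖ ≤ L * s ^ 2

theorem IsSphereCurve.nonneg {L : ℝ} {e : ℝ → E3} (h : IsSphereCurve L e) : 0 ≤ L := by
  simpa using (norm_nonneg _).trans (h.lipschitz 1 0)

theorem IsAdapted.norm_secondDiff_sq_le_of_curve {L lam δ : ℝ} {e : ℝ → E3} {u : ℕ → S2}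
    (hc : IsSphereCurve L e) (h : IsAdapted δ (fun i => e (lam * i)) u) (hlam : 0 < lam)
    (hδ : 0 < δ) (hδ2 : δ ≤ 1 / 2) (hη : (L * lam) ^ 2 ≤ δ / 4) (hlδ : lam ^ 2 ≤ δ) (i : ℕ) :
    ‖secondDiff δ u i‖ ^ 2 ≤ 36 * L ^ 2 * lam ^ 2 * δ := by
  have hL := hc.nonneg
  have hee : ∀ i : ℕ, ‖e (lam * (i + 1 : ℕ)) - e (lam * i)‖ ≤ L * lam := fun i => by
    refine (hc.lipschitz _ _).trans (le_of_eq ?_)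
    push_cast
    rw [show lam * (i + 1) - lam * i = lam by ring, abs_of_pos hlam]
  have h1 := h.norm_secondDiff_sq_le hδ hδ2 (fun i => hc.norm_eq _) hee hη i
  have hdist : ∀ j : ℕ, ‖(u j : E3) - u (j + 1)‖ ≤ Real.sqrt (2 * δ) := fun j => by
    apply Real.le_sqrt_of_sq_le
    rw [norm_sub_sq_real, h.angle j, norm_S2, norm_S2]
    linarith
  have hdist2 : ‖(u i : E3) - u (i + 2)‖ ≤ 2 * Real.sqrt (2 * δ) := by
    have h2 := norm_sub_le_norm_sub_add_norm_sub (u i : E3) (u (i + 1)) (u (i + 2))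
    have h3 := hdist i
    have h4 : ‖(u (i + 1) : E3) - u (i + 2)‖ ≤ Real.sqrt (2 * δ) := hdist (i + 1)
    linarith
  have hsec := hc.second (lam * i) lam
  rw [show lam * i + 2 * lam = lam * (i + 2 : ℕ) by push_cast; ring,
    show lam * i + lam = lam * (i + 1 : ℕ) by push_cast; ring] at hsec
  have ho : inner ℝ (u i : E3) (e (lam * i)) = 0 := h.orthogonal i
  have ho2 : inner ℝ (u (i + 2) : E3) (e (lam * (i + 2 : ℕ))) = 0 := h.orthogonal (i + 2)
  have hei := hee i
  refine h1.trans ?_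
  set e0 := e (lam * i)
  set e1 := e (lam * (i + 1 : ℕ))
  set e2 := e (lam * (i + 2 : ℕ))
  -- Orthogonality of u_i to e0 and of u_{i+2} to e2 turns the sum into a first difference of e
  -- paired with a spin increment of size √δ, plus a second difference of e. Their squares are at
  -- most 8 and 1 times L² lam² δ, whence 36 = 4 (8 + 1).
  have hsplit : inner ℝ e1 (u i : E3) + inner ℝ e1 (u (i + 2) : E3)
      = inner ℝ (e1 - e0) ((u i : E3) - u (i + 2))
        - inner ℝ (e2 - (2 : ℝ) • e1 + e0) (u (i + 2) : E3) := by
    rw [inner_sub_left, inner_sub_right, inner_sub_right, inner_add_left, inner_sub_left,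
      inner_smul_left, real_inner_comm (u i : E3) e0, real_inner_comm (u (i + 2) : E3) e2, ho, ho2]
    simp
    ring
  have hb1 : |inner ℝ (e1 - e0) ((u i : E3) - u (i + 2))|
      ≤ L * lam * (2 * Real.sqrt (2 * δ)) :=
    (abs_real_inner_le_norm _ _).trans (mul_le_mul hei hdist2 (norm_nonneg _) (by positivity))
  have hb2 : |inner ℝ (e2 - (2 : ℝ) • e1 + e0) (u (i + 2) : E3)| ≤ L * lam ^ 2 := by
    refine (abs_real_inner_le_norm _ _).trans ?_
    rw [norm_S2, mul_one]
    exact hsec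
  have hb1' := pow_le_pow_left₀ (abs_nonneg _) hb1 2
  have hb2' := pow_le_pow_left₀ (abs_nonneg _) hb2 2
  rw [sq_abs] at hb1' hb2'
  rw [hsplit]
  have hs : Real.sqrt (2 * δ) ^ 2 = 2 * δ := Real.sq_sqrt (by positivity)
  have e1' : (L * lam * (2 * Real.sqrt (2 * δ))) ^ 2 = 8 * (L ^ 2 * lam ^ 2 * δ) := by
    rw [mul_pow, mul_pow 2, hs]
    ring
  have e2' : (L * lam ^ 2) ^ 2 ≤ L ^ 2 * lam ^ 2 * δ := by
    calc (L * lam ^ 2) ^ 2 = L ^ 2 * lam ^ 2 * lam ^ 2 := by ring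
      _ ≤ _ := by gcongr
  generalize inner ℝ (e1 - e0) ((u i : E3) - u (i + 2)) = p at *
  generalize inner ℝ (e2 - (2 : ℝ) • e1 + e0) (u (i + 2) : E3) = q at *
  nlinarith [sq_nonneg (p + q)]

theorem IsAdapted.chainEnergy_le {L lam δ : ℝ} {e : ℝ → E3} {u : ℕ → S2}
    (hc : IsSphereCurve L e) (h : IsAdapted δ (fun i => e (lam * i)) u) (hlam : 0 < lam)
    (hδ : 0 < δ) (hδ2 : δ ≤ 1 / 2) (hη : (L * lam) ^ 2 ≤ δ / 4) (hlδ : lam ^ 2 ≤ δ) :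
    chainEnergy lam δ u ≤ 18 * L ^ 2 * lam ^ 2 * δ := by
  have h1 : ∑ i ∈ innerIndices lam, lam * ‖secondDiff δ u i‖ ^ 2
      ≤ ∑ _i ∈ innerIndices lam, lam * (36 * L ^ 2 * lam ^ 2 * δ) :=
    Finset.sum_le_sum fun i _ => mul_le_mul_of_nonneg_left
      (h.norm_secondDiff_sq_le_of_curve hc hlam hδ hδ2 hη hlδ i) hlam.le
  rw [Finset.sum_const, innerIndices, Finset.card_range, nsmul_eq_mul] at h1
  have h2 : ((lastIndex lam - 1 : ℕ) : ℝ) * lam ≤ 1 := by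
    refine le_trans ?_ (mul_lastIndex_le_one hlam)
    rw [mul_comm]
    gcongr
    exact Nat.sub_le _ _
  have h3 : ((lastIndex lam - 1 : ℕ) : ℝ) * (lam * (36 * L ^ 2 * lam ^ 2 * δ))
      ≤ 36 * L ^ 2 * lam ^ 2 * δ := by
    rw [← mul_assoc]
    exact mul_le_of_le_one_left (by positivity) h2
  have h4 := h1.trans h3
  unfold chainEnergy innerIndices
  simp only [secondDiff] at h4
  linarith

theorem IsAdapted.norm_chiralityField_sub_le {L lam δ : ℝ} {e : ℝ → E3} {u : ℕ → S2}
    (hc : IsSphereCurve L e) (h : IsAdapted δ (fun i => e (lam * i)) u) (hlam : 0 < lam)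
    (hlam2 : lam ≤ 1 / 2) (hδ : 0 < δ) {x : ℝ} (hx : x ∈ Set.Ioo (0 : ℝ) 1) :
    ‖chiralityField lam δ u x - e x‖
      ≤ Real.sqrt (δ + (L * lam) ^ 2 / δ) + L * (2 * lam) := by
  have hL := hc.nonneg
  have hee : ∀ i : ℕ, ‖e (lam * (i + 1 : ℕ)) - e (lam * i)‖ ≤ L * lam := fun i => by
    refine (hc.lipschitz _ _).trans (le_of_eq ?_)
    push_cast
    rw [show lam * (i + 1) - lam * i = lam by ring, abs_of_pos hlam]
  have h2 := two_le_lastIndex hlam hlam2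
  have hN := mul_lastIndex_le_one hlam
  have hN1 := one_lt_mul_lastIndex_add_one hlam
  unfold chiralityField
  set j := min ⌊x / lam⌋₊ (lastIndex lam - 1) with hj
  have h3 : ‖chirality δ u j - e (lam * (j + 1 : ℕ))‖ ≤ Real.sqrt (δ + (L * lam) ^ 2 / δ) :=
    Real.le_sqrt_of_sq_le (h.norm_chirality_sub_sq_le hδ (fun i => hc.norm_eq _) hee j)
  have h4 : |lam * (j + 1 : ℕ) - x| ≤ 2 * lam := by
    have hx0 : 0 ≤ x / lam := div_nonneg hx.1.le hlam.le
    have h5 : (j : ℝ) ≤ x / lam :=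
      le_trans (by exact_mod_cast min_le_left _ _) (Nat.floor_le hx0)
    rw [le_div_iff₀ hlam] at h5
    have h6 : x ≤ lam * (j + 2) := by
      rcases le_total ⌊x / lam⌋₊ (lastIndex lam - 1) with h | h
      · rw [hj, min_eq_left h]
        have := Nat.lt_floor_add_one (x / lam)
        rw [div_lt_iff₀ hlam] at this
        nlinarith
      · rw [hj, min_eq_right h, Nat.cast_sub (by omega)]
        push_cast
        nlinarith [hx.2]
    push_cast
    rw [abs_le]
    constructor <;> nlinarith
  refine (norm_sub_le_norm_sub_add_norm_sub _ (e (lam * (j + 1 : ℕ))) _).trans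
    (add_le_add h3 ((hc.lipschitz _ _).trans (by gcongr)))

/-! ### Weak density of curves on the sphere -/

/-- As φ is only integrable, Hölder does not apply. Along a subsequence the convergence is almost
everywhere, and |φ| dominates. -/
theorem tendsto_pairing_of_tendsto_eLpNorm {f : ℕ → ℝ → E3} {z φ : ℝ → E3}
    (hf : ∀ n, AEStronglyMeasurable (f n) muI) (hf1 : ∀ n, ∀ᵐ x ∂muI, ‖f n x‖ ≤ 1)
    (hz : AEStronglyMeasurable z muI)
    (h : Tendsto (fun n => eLpNorm (f n - z) 1 muI) atTop (𝓝 0)) (hφ : Integrable φ muI) :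
    Tendsto (fun n => ∫ x, inner ℝ (f n x) (φ x) ∂muI) atTop
      (𝓝 (∫ x, inner ℝ (z x) (φ x) ∂muI)) := by
  refine tendsto_of_subseq_tendsto fun ns hns => ?_
  have hm : TendstoInMeasure muI (fun n => f (ns n)) atTop z :=
    tendstoInMeasure_of_tendsto_eLpNorm one_ne_zero (fun n => hf (ns n)) hz (h.comp hns)
  obtain ⟨ms, -, hms⟩ := hm.exists_seq_tendsto_ae
  refine ⟨ms, tendsto_integral_of_dominated_convergence (fun x => ‖φ x‖)
    (fun n => (hf _).inner hφ.1) hφ.norm (fun n => ?_) ?_⟩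
  · filter_upwards [hf1 (ns (ms n))] with x hx
    exact (norm_inner_le_norm _ _).trans (mul_le_of_le_one_left (norm_nonneg _) hx)
  · filter_upwards [hms] with x hx
    exact hx.inner tendsto_const_nhds

theorem exists_orthonormal_frame (y : E3) :
    ∃ p : E3 × E3, ‖p.1‖ = 1 ∧ ‖p.2‖ = 1 ∧ inner ℝ p.1 p.2 = 0 ∧ inner ℝ y p.1 = 0 ∧
      inner ℝ y p.2 = 0 := by
  obtain ⟨n, hn, hyn, -⟩ := exists_unit_orthogonal y y
  obtain ⟨b, hb, hyb, hnb⟩ := exists_unit_orthogonal y n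
  exact ⟨(n, b), hn, hb, hnb, hyn, hyb⟩

theorem norm_add_rotation {y n b : E3} (hn : ‖n‖ = 1) (hb : ‖b‖ = 1) (hnb : inner ℝ n b = 0)
    (hyn : inner ℝ y n = 0) (hyb : inner ℝ y b = 0) (hy : ‖y‖ ≤ 1) (θ : ℝ) :
    ‖y + Real.sqrt (1 - ‖y‖ ^ 2) • (Real.cos θ • n + Real.sin θ • b)‖ = 1 := by
  have hs : 0 ≤ 1 - ‖y‖ ^ 2 := by
    have := pow_le_one₀ (n := 2) (norm_nonneg y) hy
    linarith
  have h1 : ‖Real.cos θ • n + Real.sin θ • b‖ ^ 2 = 1 := by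
    rw [norm_add_sq_real, norm_smul, norm_smul, hn, hb, inner_smul_left, inner_smul_right, hnb]
    simp
  have h2 : inner ℝ y (Real.cos θ • n + Real.sin θ • b) = 0 := by
    rw [inner_add_right, inner_smul_right, inner_smul_right, hyn, hyb]
    simp
  rw [← sq_eq_sq₀ (norm_nonneg _) zero_le_one, norm_add_sq_real, inner_smul_right, h2, norm_smul,
    mul_pow, h1, Real.norm_eq_abs, sq_abs, Real.sq_sqrt hs]
  ring

/-- Every simple function with values in the unit ball is a weak limit of functions with values
in the unit sphere. -/
theorem exists_sphere_valued_tendsto (s : SimpleFunc ℝ E3) (hs : ∀ x, ‖s x‖ ≤ 1) :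
    ∃ g : ℕ → ℝ → E3, (∀ m, Measurable (g m)) ∧ (∀ m x, ‖g m x‖ = 1) ∧
      ∀ φ : ℝ → E3, Integrable φ muI →
        Tendsto (fun m => ∫ x, inner ℝ (g m x) (φ x) ∂muI) atTop
          (𝓝 (∫ x, inner ℝ (s x) (φ x) ∂muI)) := by
  -- The frame is chosen pointwise without regularity; composed with the simple function s it takes
  -- finitely many values and is measurable.
  choose p hp1 hp2 hp12 hyp1 hyp2 using exists_orthonormal_frame
  set r : ℝ → ℝ := fun x => Real.sqrt (1 - ‖s x‖ ^ 2) with hr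
  set N : ℝ → E3 := fun x => (p (s x)).1 with hN
  set B : ℝ → E3 := fun x => (p (s x)).2 with hB
  have hrm : Measurable r := (s.map fun y => Real.sqrt (1 - ‖y‖ ^ 2)).measurable
  have hNm : Measurable N := (s.map fun y => (p y).1).measurable
  have hBm : Measurable B := (s.map fun y => (p y).2).measurable
  have hr1 : ∀ x, |r x| ≤ 1 := fun x => by
    rw [abs_of_nonneg (Real.sqrt_nonneg _)]
    exact Real.sqrt_le_one.2 (by nlinarith [sq_nonneg ‖s x‖])
  refine ⟨fun m x => s x + r x • (Real.cos (2 * Real.pi * (x * m)) • N x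
      + Real.sin (2 * Real.pi * (x * m)) • B x), fun m => ?_, fun m x => ?_, fun φ hφ => ?_⟩
  · have := s.measurable
    fun_prop
  · exact norm_add_rotation (hp1 _) (hp2 _) (hp12 _) (hyp1 _) (hyp2 _) (hs x) _
  have hA : Integrable (fun x => inner ℝ (r x • N x) (φ x)) muI :=
    integrable_inner_of_bound (hrm.smul hNm).aestronglyMeasurable 1
      (Eventually.of_forall fun x => by
        rw [norm_smul, hp1, mul_one]
        exact hr1 x) hφ
  have hC : Integrable (fun x => inner ℝ (r x • B x) (φ x)) muI :=
    integrable_inner_of_bound (hrm.smul hBm).aestronglyMeasurable 1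
      (Eventually.of_forall fun x => by
        rw [norm_smul, hp2, mul_one]
        exact hr1 x) hφ
  have hS : Integrable (fun x => inner ℝ (s x) (φ x)) muI :=
    integrable_inner_of_bound s.measurable.aestronglyMeasurable 1
      (Eventually.of_forall hs) hφ
  -- Packs the cosine and sine coefficients into one complex function, so that the oscillating part
  -- is the real part of a Fourier integral and Riemann-Lebesgue applies.
  set f : ℝ → ℂ := fun x => (inner ℝ (r x • N x) (φ x) : ℝ)
    + (inner ℝ (r x • B x) (φ x) : ℝ) * Complex.I with hf
  have hfi : Integrable f muI := hA.ofReal.add (hC.ofReal.mul_const _)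
  have hRL := Real.tendsto_integral_exp_smul_cocompact ((Set.Ioo (0 : ℝ) 1).indicator f)
  have hRL2 : Tendsto (fun m : ℕ => ∫ x, Real.fourierChar (-(x * (m : ℝ))) • f x ∂muI) atTop
      (𝓝 0) := by
    have h1 : Tendsto (fun m : ℕ => (m : ℝ)) atTop (cocompact ℝ) :=
      tendsto_natCast_atTop_atTop.mono_right atTop_le_cocompact
    refine (hRL.comp h1).congr fun m => ?_
    rw [← integral_indicator measurableSet_Ioo]
    simp only [Function.comp]
    congr 1
    ext x
    by_cases hx : x ∈ Set.Ioo (0 : ℝ) 1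
    · rw [Set.indicator_of_mem hx, Set.indicator_of_mem hx]
    · rw [Set.indicator_of_notMem hx, Set.indicator_of_notMem hx, smul_zero]
  have hRL3 := ((Complex.continuous_re.tendsto 0).comp hRL2).const_add
    (∫ x, inner ℝ (s x) (φ x) ∂muI)
  rw [Complex.zero_re, add_zero] at hRL3
  refine hRL3.congr fun m => ?_
  have hint : Integrable (fun x => Real.fourierChar (-(x * (m : ℝ))) • f x) muI := by
    refine hfi.mono ?_ (Eventually.of_forall fun x => (Circle.norm_smul _ _).le)
    exact (Continuous.aestronglyMeasurable (by fun_prop)).smul hfi.1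
  have hre := Complex.reCLM.integral_comp_comm hint
  simp only [Complex.reCLM_apply] at hre
  simp only [Function.comp]
  have hrei : Integrable (fun x => (Real.fourierChar (-(x * (m : ℝ))) • f x).re) muI :=
    Complex.reCLM.integrable_comp hint
  rw [← hre, ← integral_add hS hrei]
  congr 1
  ext x
  have hθ : (Real.fourierChar (-(x * (m : ℝ))) • f x).re
      = Real.cos (2 * Real.pi * (x * m)) * inner ℝ (r x • N x) (φ x)
        + Real.sin (2 * Real.pi * (x * m)) * inner ℝ (r x • B x) (φ x) := by
    rw [Circle.smul_def, Real.fourierChar_apply, smul_eq_mul, hf, Complex.mul_re,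
      Complex.exp_ofReal_mul_I_re, Complex.exp_ofReal_mul_I_im]
    simp
  rw [hθ]
  simp only [inner_add_left, real_inner_smul_left]
  ring

/-! ### Smoothing to curves of class C^{1,1} -/

theorem norm_inv_smul_sub_le {w g : E3} (hw : w ≠ 0) (hg : ‖g‖ = 1) :
    ‖‖w‖⁻¹ • w - g‖ ≤ 2 * ‖w - g‖ := by
  have hw' : ‖w‖ ≠ 0 := norm_ne_zero_iff.2 hw
  have h1 : ‖‖w‖⁻¹ • w - w‖ ≤ ‖w - g‖ := by
    have : ‖w‖⁻¹ • w - w = (1 - ‖w‖) • (‖w‖⁻¹ • w) := by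
      rw [sub_smul, one_smul, smul_smul, mul_inv_cancel₀ hw', one_smul]
    rw [this, norm_smul, norm_smul, norm_inv, norm_norm, inv_mul_cancel₀ hw', mul_one,
      Real.norm_eq_abs, ← hg, norm_sub_rev]
    exact abs_norm_sub_norm_le _ _
  have h2 := norm_sub_le_norm_sub_add_norm_sub (‖w‖⁻¹ • w) w g
  linarith

/-- A smooth unit-valued curve that is constant outside a compact set is of class `C^{1,1}`. -/
theorem exists_isSphereCurve {f : ℝ → E3} (hf : ContDiff ℝ 2 f) (hf1 : ∀ t, ‖f t‖ = 1) {c : E3}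
    (hc : HasCompactSupport fun t => f t - c) : ∃ L, IsSphereCurve L f := by
  set F : ℝ → E3 := fun t => f t - c with hF
  have hFs : ContDiff ℝ 2 F := hf.sub contDiff_const
  have hF's : ContDiff ℝ 1 (deriv F) := by
    have h2 : ContDiff ℝ (1 + 1) F := by
      rw [one_add_one_eq_two]
      exact hFs
    exact (contDiff_succ_iff_deriv.1 h2).2.2
  obtain ⟨K, hK⟩ := hFs.lipschitzWith_of_hasCompactSupport hc (by norm_num)
  obtain ⟨K', hK'⟩ := hF's.lipschitzWith_of_hasCompactSupport hc.deriv (by norm_num)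
  have hFd : Differentiable ℝ F := hFs.differentiable (by norm_num)
  refine ⟨max K K', hf1, fun t s => ?_, fun t s => ?_⟩
  · have h1 := hK.dist_le_mul t s
    rw [dist_eq_norm, Real.dist_eq] at h1
    have h2 : F t - F s = f t - f s := by simp [hF]
    rw [← h2]
    exact h1.trans (mul_le_mul_of_nonneg_right (le_max_left _ _) (abs_nonneg _))
  · set G : ℝ → E3 := fun y => F (y + s) - F y with hG
    have hGd : ∀ y, HasDerivAt G (deriv F (y + s) - deriv F y) y := fun y =>
      ((hFd (y + s)).hasDerivAt.comp_add_const y s).sub (hFd y).hasDerivAt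
    have hGb : ∀ y, ‖deriv F (y + s) - deriv F y‖ ≤ K' * |s| := fun y => by
      have h1 := hK'.dist_le_mul (y + s) y
      rwa [dist_eq_norm, Real.dist_eq, add_sub_cancel_left] at h1
    have h1 := convex_univ.norm_image_sub_le_of_norm_hasDerivWithin_le
      (fun y _ => (hGd y).hasDerivWithinAt) (fun y _ => hGb y) (Set.mem_univ t)
      (Set.mem_univ (t + s))
    have h2 : G (t + s) - G t = f (t + 2 * s) - (2 : ℝ) • f (t + s) + f t := by
      simp only [hG, hF, two_smul]
      rw [show t + s + s = t + 2 * s by ring]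
      abel
    rw [← h2]
    refine h1.trans ?_
    rw [add_sub_cancel_left, Real.norm_eq_abs, mul_assoc, ← sq, sq_abs]
    exact mul_le_mul_of_nonneg_right (le_max_right _ _) (sq_nonneg _)

theorem exists_isSphereCurve_eLpNorm_sub_le {g : ℝ → E3} (hg : AEStronglyMeasurable g muI)
    (hg1 : ∀ x, ‖g x‖ = 1) {ε : ℝ} (hε : 0 < ε) :
    ∃ L f, IsSphereCurve L f ∧ eLpNorm (f - g) 1 muI ≤ ENNReal.ofReal ε := by
  have hgi : MemLp g 1 muI := memLp_one_iff_integrable.2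
    (integrable_of_bound hg 1 fun x => (hg1 x).le)
  obtain ⟨h, hcomp, hsm, hh⟩ := hgi.exist_eLpNorm_sub_le ENNReal.one_ne_top le_rfl
    (ε := ε / 4) (by positivity)
  -- A smooth curve in three-space has a range with dense complement, so a small shift c makes h + c
  -- vanish nowhere and it can be normalized. Outside the support of h the result is the constant
  -- c/|c|.
  have hdense : Dense (Set.range fun x => -h x)ᶜ :=
    ContDiff.dense_compl_range_of_finrank_lt_finrank
      (hsm.neg.of_le (by exact_mod_cast le_top)) (by simp)
  obtain ⟨c, hc, hcε⟩ := hdense.exists_dist_lt 0 (ε := ε / 4) (by positivity)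
  have hne : ∀ x, h x + c ≠ 0 := fun x hx => hc ⟨x, neg_eq_of_add_eq_zero_right hx⟩
  rw [dist_zero_left] at hcε
  set f : ℝ → E3 := fun x => ‖h x + c‖⁻¹ • (h x + c) with hf
  have hfs : ContDiff ℝ 2 f := by
    have h1 : ContDiff ℝ 2 fun x => h x + c :=
      (contDiff_infty.1 hsm 2).add contDiff_const
    exact ((h1.norm ℝ hne).inv fun x => norm_ne_zero_iff.2 (hne x)).smul h1
  have hf1 : ∀ x, ‖f x‖ = 1 := fun x => by
    rw [hf, norm_smul, norm_inv, norm_norm, inv_mul_cancel₀ (norm_ne_zero_iff.2 (hne x))]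
  have hfc : HasCompactSupport fun x => f x - ‖c‖⁻¹ • c := by
    refine hcomp.mono fun x hx hx0 => hx ?_
    simp [hf, hx0]
  obtain ⟨L, hL⟩ := exists_isSphereCurve hfs hf1 hfc
  refine ⟨L, f, hL, ?_⟩
  have hhm : AEStronglyMeasurable h muI := hsm.continuous.aestronglyMeasurable
  have hpt : ∀ x, ‖(f - g) x‖ ≤ 2 * ‖(h - g + Function.const ℝ c) x‖ := fun x => by
    have := norm_inv_smul_sub_le (hne x) (hg1 x)
    rw [add_sub_right_comm] at this
    exact this
  have h1 := eLpNorm_le_mul_eLpNorm_of_ae_le_mul (μ := muI) (Eventually.of_forall hpt) 1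
  refine h1.trans ?_
  have h2 : eLpNorm (h - g + Function.const ℝ c) 1 muI
      ≤ ENNReal.ofReal (ε / 4) + ENNReal.ofReal (ε / 4) := by
    refine (eLpNorm_add_le (hhm.sub hg) aestronglyMeasurable_const le_rfl).trans
      (add_le_add ?_ ?_)
    · rwa [eLpNorm_sub_comm]
    · rw [eLpNorm_const' _ one_ne_zero ENNReal.one_ne_top]
      simp only [measure_univ, ENNReal.one_rpow, mul_one]
      rw [← ofReal_norm]
      exact ENNReal.ofReal_le_ofReal hcε.le
  rw [← ENNReal.ofReal_add (by positivity) (by positivity)] at h2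
  refine (mul_le_mul_right h2 _).trans (le_of_eq ?_)
  rw [← ENNReal.ofReal_mul two_pos.le]
  congr 1
  ring

theorem IsSphereCurve.continuous {L : ℝ} {e : ℝ → E3} (h : IsSphereCurve L e) : Continuous e :=
  (LipschitzWith.of_dist_le_mul (K := ⟨L, h.nonneg⟩) fun t s => by
    rw [dist_eq_norm, Real.dist_eq]
    exact h.lipschitz t s).continuous

/-- The curves of class `C^{1,1}` on the unit sphere are weakly* dense in the unit ball. -/
theorem exists_isSphereCurve_pairing_lt {z : ℝ → E3} (hz : Measurable z)
    (hz1 : ∀ᵐ x ∂muI, ‖z x‖ ≤ 1) (φ : ℕ → ℝ → E3) (hφ : ∀ j, Integrable (φ j) muI) (k : ℕ)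
    {ε : ℝ} (hε : 0 < ε) :
    ∃ L f, IsSphereCurve L f ∧ ∀ j ∈ Finset.range k,
      |∫ x, inner ℝ (f x) (φ j x) ∂muI - ∫ x, inner ℝ (z x) (φ j x) ∂muI| < ε := by
  have key : ∀ {a : ℕ → ℕ → ℝ} {b : ℕ → ℝ}, (∀ j, Tendsto (fun n => a n j) atTop (𝓝 (b j))) →
      ∃ n, ∀ j ∈ Finset.range k, |a n j - b j| < ε / 3 := fun {a b} h =>
    ((eventually_all_finset _).2 fun j _ =>
      ((Metric.tendsto_nhds.1 (h j)) (ε / 3) (by positivity))).exists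
  have h0 : (0 : E3) ∈ Metric.closedBall (0 : E3) 1 := by simp
  have hzi : Integrable z muI := Integrable.of_bound hz.aestronglyMeasurable 1 hz1
  have hs := SimpleFunc.tendsto_approxOn_L1_enorm hz h0
    (hz1.mono fun x hx => subset_closure (by simpa using hx)) (by simpa using hzi.2)
  set s := SimpleFunc.approxOn z hz (Metric.closedBall (0 : E3) 1) 0 h0
  have hs1 : ∀ n x, ‖s n x‖ ≤ 1 := fun n x => by
    simpa using SimpleFunc.approxOn_mem hz h0 n x
  obtain ⟨n, hn⟩ := key fun j => tendsto_pairing_of_tendsto_eLpNorm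
    (f := fun n => s n) (z := z) (fun n => (s n).measurable.aestronglyMeasurable)
    (fun n => Eventually.of_forall (hs1 n)) hz.aestronglyMeasurable
    (by simpa [eLpNorm_one_eq_lintegral_enorm] using! hs) (hφ j)
  obtain ⟨g, hgm, hg1, hg⟩ := exists_sphere_valued_tendsto (s n) (hs1 n)
  obtain ⟨m, hm⟩ := key fun j => hg (φ j) (hφ j)
  choose L f hf hfg using fun l : ℕ => exists_isSphereCurve_eLpNorm_sub_le
    (hgm m).aestronglyMeasurable (hg1 m) (ε := 1 / ((l : ℝ) + 1)) (by positivity)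
  obtain ⟨l, hl⟩ := key fun j => tendsto_pairing_of_tendsto_eLpNorm (f := f) (z := g m)
    (fun l => (hf l).continuous.aestronglyMeasurable)
    (fun l => Eventually.of_forall fun x => ((hf l).norm_eq x).le) (hgm m).aestronglyMeasurable
    (tendsto_of_tendsto_of_tendsto_of_le_of_le tendsto_const_nhds (by
      have := ENNReal.tendsto_ofReal tendsto_one_div_add_atTop_nhds_zero_nat
      rwa [ENNReal.ofReal_zero] at this) (fun _ => bot_le) hfg) (hφ j)
  refine ⟨L l, f l, hf l, fun j hj => ?_⟩
  have h1 := abs_lt.1 (hn j hj)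
  have h2 := abs_lt.1 (hm j hj)
  have h3 := abs_lt.1 (hl j hj)
  rw [abs_lt]
  constructor <;> linarith [h1.1, h1.2, h2.1, h2.2, h3.1, h3.2]

/-! ### Recovery sequences -/

theorem scaledHslR_le_of_chain {R lam δ K : ℝ} (hlam : 0 < lam) (hδ : 0 < δ) {z : L1I}
    {u : ℕ → S2} (hzR : eLpNorm z ∞ muI ≤ ENNReal.ofReal R) (hu : BoundaryCondition lam u)
    (hz : z =ᵐ[muI] chiralityField lam δ u)
    (hE : chainEnergy lam δ u ≤ K * (Real.sqrt 2 * lam * (δ * Real.sqrt δ))) :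
    scaledHslR R lam δ z ≤ ENNReal.ofReal K := by
  have hD : 0 < Real.sqrt 2 * lam * (δ * Real.sqrt δ) := by positivity
  rw [scaledHslR, rpow_three_halves hδ, HslR, if_pos hzR]
  refine ENNReal.div_le_of_le_mul ?_
  rw [← ENNReal.ofReal_mul' hD.le]
  exact (iInf₂_le_of_le u hu (iInf_le _ hz)).trans (ENNReal.ofReal_le_ofReal hE)

theorem IsAdapted.norm_chirality_le_one {δ : ℝ} {e : ℕ → E3} {u : ℕ → S2}
    (h : IsAdapted δ e u) (hδ : 0 < δ) (i : ℕ) : ‖chirality δ u i‖ ≤ 1 := by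
  have h5 : ‖chirality δ u i‖ ^ 2 = 1 - δ / 2 := by
    rw [norm_chirality_sq hδ, h.angle i]
    field_simp
    ring
  rw [← abs_norm, ← sq_le_one_iff_abs_le_one, h5]
  linarith

/-- Spin chains whose chirality follows a given curve at negligible energy. -/
theorem eventually_exists_chirality_near {R : ℝ} (hR : 1 < R) {lam δ : ℕ → ℝ}
    (hlam_pos : ∀ n, 0 < lam n) (hlam : Tendsto lam atTop (𝓝 0))
    (hδ_pos : ∀ n, 0 < δ n) (hδ : Tendsto δ atTop (𝓝 0))
    (hscale : Tendsto (fun n => lam n / Real.sqrt (δ n)) atTop (𝓝 0))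
    {L : ℝ} {e : ℝ → E3} (he : IsSphereCurve L e) {ε : ℝ} (hε : 0 < ε) :
    ∀ᶠ n in atTop, ∃ z : L1I, (∀ᵐ x ∂muI, ‖z x‖ ≤ 1) ∧
      scaledHslR R (lam n) (δ n) z ≤ ENNReal.ofReal ε ∧ ∀ᵐ x ∂muI, ‖z x - e x‖ ≤ ε := by
  have hq : Tendsto (fun n => lam n ^ 2 / δ n) atTop (𝓝 0) := by
    have := hscale.pow 2
    rw [zero_pow two_ne_zero] at this
    refine this.congr fun n => ?_
    rw [div_pow, Real.sq_sqrt (hδ_pos n).le]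
  have hq1 := (hq.const_mul (L ^ 2))
  rw [mul_zero] at hq1
  have herr : Tendsto (fun n => Real.sqrt (δ n + L ^ 2 * (lam n ^ 2 / δ n)) + L * (2 * lam n))
      atTop (𝓝 0) := by
    have := ((hδ.add hq1).sqrt).add ((hlam.const_mul 2).const_mul L)
    simpa using this
  have hen := hscale.const_mul (18 * L ^ 2)
  rw [mul_zero] at hen
  filter_upwards [hlam.eventually (ge_mem_nhds (by norm_num : (0 : ℝ) < 1 / 2)),
    hδ.eventually (ge_mem_nhds (by norm_num : (0 : ℝ) < 1 / 2)),
    hq.eventually (ge_mem_nhds one_pos), hq1.eventually (ge_mem_nhds (by norm_num : (0 : ℝ) < 1 / 4)),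
    herr.eventually (ge_mem_nhds hε), hen.eventually (ge_mem_nhds hε)] with n h1 h2 h3 h4 h5 h6
  have hl := hlam_pos n
  have hd := hδ_pos n
  rw [div_le_one hd] at h3
  have hη : (L * lam n) ^ 2 ≤ δ n / 4 := by
    rw [mul_div_assoc', div_le_iff₀ hd] at h4
    rw [mul_pow]
    linarith
  obtain ⟨u, hu⟩ := exists_isAdapted hd h2 (e := fun i => e (lam n * i))
    (fun i => he.norm_eq _) (fun i => by
      refine le_trans (pow_le_pow_left₀ (norm_nonneg _) (he.lipschitz _ _) 2) ?_
      push_cast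
      rwa [show lam n * (i + 1) - lam n * i = lam n by ring, abs_of_pos hl])
  have hfield : ∀ x, ‖chiralityField (lam n) (δ n) u x‖ ≤ 1 := fun x =>
    hu.norm_chirality_le_one hd _
  have hint : MemLp (chiralityField (lam n) (δ n) u) 1 muI := memLp_one_iff_integrable.2
    (integrable_of_bound (measurable_chiralityField _ _ u).aestronglyMeasurable 1 hfield)
  have hz := hint.coeFn_toLp
  have hz1 : ∀ᵐ x ∂muI, ‖(hint.toLp _ : L1I) x‖ ≤ 1 := by
    filter_upwards [hz] with x hx
    rw [hx]
    exact hfield x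
  refine ⟨hint.toLp _, hz1, ?_, ?_⟩
  · refine scaledHslR_le_of_chain hl hd (u := u) ?_ ?_ hz ?_
    · rw [eLpNorm_exponent_top]
      refine eLpNormEssSup_le_of_ae_bound (hz1.mono fun x hx => hx.trans hR.le)
    · have hN := two_le_lastIndex hl h1
      -- All consecutive scalar products of the chain equal 1 - δ, so the boundary condition is
      -- automatic.
      have ha := hu.angle (lastIndex (lam n) - 1)
      rw [Nat.sub_add_cancel (by omega)] at ha
      rw [BoundaryCondition, real_inner_comm, hu.angle 0, real_inner_comm, ha]
    · refine (hu.chainEnergy_le he hl hd h2 hη h3).trans ?_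
      have hs : 0 < Real.sqrt (δ n) := Real.sqrt_pos.2 hd
      have h2s : 1 ≤ Real.sqrt 2 := Real.one_le_sqrt.2 one_le_two
      have e1 : 18 * L ^ 2 * lam n ^ 2 * δ n
          = 18 * L ^ 2 * (lam n / Real.sqrt (δ n)) * (lam n * (δ n * Real.sqrt (δ n))) := by
        field_simp
      rw [e1]
      refine mul_le_mul h6 ?_ (by positivity) hε.le
      rw [mul_assoc]
      exact le_mul_of_one_le_left (by positivity) h2s
  · filter_upwards [hz, ae_restrict_mem measurableSet_Ioo] with x hx hxI
    rw [hx]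
    refine (hu.norm_chiralityField_sub_le he hl h1 hd hxI).trans ?_
    rwa [mul_pow, mul_div_assoc]

theorem abs_integral_inner_sub_le {f g φ : ℝ → E3} (hf : AEStronglyMeasurable f muI)
    (hf1 : ∀ᵐ x ∂muI, ‖f x‖ ≤ 1) (hg : AEStronglyMeasurable g muI)
    (hg1 : ∀ᵐ x ∂muI, ‖g x‖ ≤ 1) (hφ : Integrable φ muI) {ε : ℝ}
    (h : ∀ᵐ x ∂muI, ‖f x - g x‖ ≤ ε) :
    |∫ x, inner ℝ (f x) (φ x) ∂muI - ∫ x, inner ℝ (g x) (φ x) ∂muI| ≤ ε * ∫ x, ‖φ x‖ ∂muI := by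
  rw [← integral_sub (integrable_inner_of_bound hf 1 hf1 hφ)
    (integrable_inner_of_bound hg 1 hg1 hφ), ← integral_const_mul, ← Real.norm_eq_abs]
  refine norm_integral_le_of_norm_le (hφ.norm.const_mul ε) ?_
  filter_upwards [h] with x hx
  rw [← inner_sub_left]
  exact (norm_inner_le_norm _ _).trans (mul_le_mul_of_nonneg_right hx (norm_nonneg _))

/-- Good approximations for every fixed precision give a sequence of good approximations. -/
theorem exists_diagonal {P : ℕ → ℕ → Prop} (h : ∀ k, ∀ᶠ n in atTop, P k n) :
    ∃ K : ℕ → ℕ, Tendsto K atTop atTop ∧ ∀ᶠ n in atTop, P (K n) n := by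
  classical
  -- K n is the largest k ≤ n for which P k n holds.
  refine ⟨fun n => Nat.findGreatest (fun k => P k n) n, tendsto_atTop.2 fun k => ?_, ?_⟩
  · filter_upwards [h k, eventually_ge_atTop k] with n hn hk
    exact Nat.le_findGreatest hk hn
  · filter_upwards [h 0] with n hn
    exact Nat.findGreatest_spec (P := fun k => P k n) (Nat.zero_le n) hn

theorem memLp_top_of_norm_le_one {z : L1I} (hz : ∀ᵐ x ∂muI, ‖z x‖ ≤ 1) : MemLp z ∞ muI :=
  memLp_top_of_bound (Lp.aestronglyMeasurable z) 1 hz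

/-- For sequences in the unit ball, weak* convergence may be tested on a dense set. -/
theorem weakStarTendsto_of_dense {z : ℕ → L1I} {z₀ : L1I} (hz : ∀ n, ∀ᵐ x ∂muI, ‖z n x‖ ≤ 1)
    (hz₀ : ∀ᵐ x ∂muI, ‖z₀ x‖ ≤ 1) {φ : ℕ → L1I} (hφ : DenseRange φ)
    (h : ∀ j, Tendsto (fun n => ∫ x, inner ℝ (z n x) (φ j x) ∂muI) atTop
      (𝓝 (∫ x, inner ℝ (z₀ x) (φ j x) ∂muI))) : WeakStarTendsto z z₀ := by
  refine ⟨fun n => memLp_top_of_norm_le_one (hz n), memLp_top_of_norm_le_one hz₀, fun ψ => ?_⟩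
  have hdiff : ∀ (w : L1I), (∀ᵐ x ∂muI, ‖w x‖ ≤ 1) → ∀ j,
      |∫ x, inner ℝ (w x) (ψ x) ∂muI - ∫ x, inner ℝ (w x) (φ j x) ∂muI| ≤ dist ψ (φ j) := by
    intro w hw j
    have hi : ∀ χ : L1I, Integrable (fun x => inner ℝ (w x) (χ x)) muI := fun χ =>
      integrable_inner_of_bound (Lp.aestronglyMeasurable w) 1 hw (L1.integrable_coeFn χ)
    rw [dist_eq_norm, L1.norm_eq_integral_norm, ← integral_sub (hi ψ) (hi (φ j)),
      ← Real.norm_eq_abs]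
    refine norm_integral_le_of_norm_le (L1.integrable_coeFn _).norm ?_
    filter_upwards [hw, Lp.coeFn_sub ψ (φ j)] with x hx hx2
    rw [← inner_sub_right, hx2]
    exact (norm_inner_le_norm _ _).trans (mul_le_of_le_one_left (norm_nonneg _) hx)
  rw [Metric.tendsto_nhds]
  intro ε hε
  obtain ⟨j, hj⟩ := hφ.exists_dist_lt ψ (ε := ε / 3) (by positivity)
  filter_upwards [Metric.tendsto_nhds.1 (h j) (ε / 3) (by positivity)] with n hn
  rw [Real.dist_eq] at hn ⊢
  have h1 := abs_lt.1 ((hdiff (z n) (hz n) j).trans_lt hj)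
  have h2 := abs_lt.1 ((hdiff z₀ hz₀ j).trans_lt hj)
  have h3 := abs_lt.1 hn
  rw [abs_lt]
  constructor <;> linarith [h1.1, h1.2, h2.1, h2.2, h3.1, h3.2]

theorem exists_recovery_sequence {R : ℝ} (hR : 1 < R) {lam δ : ℕ → ℝ}
    (hlam_pos : ∀ n, 0 < lam n) (hlam : Tendsto lam atTop (𝓝 0))
    (hδ_pos : ∀ n, 0 < δ n) (hδ : Tendsto δ atTop (𝓝 0))
    (hscale : Tendsto (fun n => lam n / Real.sqrt (δ n)) atTop (𝓝 0))
    {z₀ : L1I} (hz₀ : ∀ᵐ x ∂muI, ‖z₀ x‖ ≤ 1) :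
    ∃ z : ℕ → L1I, WeakStarTendsto z z₀ ∧
      Tendsto (fun n => scaledHslR R (lam n) (δ n) (z n)) atTop (𝓝 0) := by
  have : Fact ((1 : ℝ≥0∞) ≠ ∞) := ⟨ENNReal.one_ne_top⟩
  have : SecondCountableTopology L1I := Lp.SecondCountableTopology
  obtain ⟨φ, hφ⟩ := TopologicalSpace.exists_dense_seq L1I
  have hφi : ∀ j, Integrable (φ j) muI := fun j => L1.integrable_coeFn (φ j)
  let Q : ℕ → ℕ → L1I → Prop := fun k n z => (∀ᵐ x ∂muI, ‖z x‖ ≤ 1) ∧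
    scaledHslR R (lam n) (δ n) z ≤ ENNReal.ofReal (1 / ((k : ℝ) + 1)) ∧
    ∀ j ∈ Finset.range k, |∫ x, inner ℝ (z x) (φ j x) ∂muI - ∫ x, inner ℝ (z₀ x) (φ j x) ∂muI|
      ≤ 1 / ((k : ℝ) + 1) * (∫ x, ‖φ j x‖ ∂muI + 1)
  have hQ : ∀ k : ℕ, ∀ᶠ n in atTop, ∃ z, Q k n z := by
    intro k
    have hk : (0 : ℝ) < 1 / ((k : ℝ) + 1) := by positivity
    obtain ⟨L, e, he, hez⟩ := exists_isSphereCurve_pairing_lt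
      (Lp.stronglyMeasurable z₀).measurable hz₀ (fun j => φ j) hφi k hk
    filter_upwards [eventually_exists_chirality_near hR hlam_pos hlam hδ_pos hδ hscale he hk]
      with n hn
    obtain ⟨z, hz1, hzE, hze⟩ := hn
    refine ⟨z, hz1, hzE, fun j hj => ?_⟩
    have h1 := abs_integral_inner_sub_le (Lp.aestronglyMeasurable z) hz1
      he.continuous.aestronglyMeasurable (Eventually.of_forall fun x => (he.norm_eq x).le)
      (hφi j) hze
    have h2 := hez j hj
    have h3 := abs_sub_le (∫ x, inner ℝ (z x) (φ j x) ∂muI) (∫ x, inner ℝ (e x) (φ j x) ∂muI)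
      (∫ x, inner ℝ (z₀ x) (φ j x) ∂muI)
    linarith
  obtain ⟨K, hK, hQK⟩ := exists_diagonal hQ
  have hz : ∀ n, ∃ z : L1I, (∀ᵐ x ∂muI, ‖z x‖ ≤ 1) ∧ ((∃ z, Q (K n) n z) → Q (K n) n z) := by
    intro n
    by_cases h : ∃ z, Q (K n) n z
    · obtain ⟨z, h1⟩ := h
      exact ⟨z, h1.1, fun _ => h1⟩
    -- A default for the finitely many n without a good approximation; z₀ keeps the uniform bound by
    -- 1.
    · exact ⟨z₀, hz₀, fun h' => absurd h' h⟩
  choose z hz1 hz2 using hz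
  have hKlim : Tendsto (fun n => 1 / ((K n : ℝ) + 1)) atTop (𝓝 0) :=
    tendsto_one_div_add_atTop_nhds_zero_nat.comp hK
  refine ⟨z, weakStarTendsto_of_dense hz1 hz₀ hφ fun j => ?_, ?_⟩
  · have h0 := hKlim.mul_const (∫ x, ‖φ j x‖ ∂muI + 1)
    rw [zero_mul] at h0
    rw [tendsto_iff_dist_tendsto_zero]
    refine squeeze_zero' (Eventually.of_forall fun n => dist_nonneg) ?_ h0
    filter_upwards [hQK, hK.eventually_gt_atTop j] with n hn hj
    exact (hz2 n hn).2.2 j (Finset.mem_range.2 hj)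
  · have h0 := ENNReal.tendsto_ofReal hKlim
    rw [ENNReal.ofReal_zero] at h0
    refine tendsto_of_tendsto_of_tendsto_of_le_of_le' tendsto_const_nhds h0
      (Eventually.of_forall fun n => bot_le) ?_
    filter_upwards [hQK] with n hn
    exact (hz2 n hn).2.1

end SpinChain

end

theorem theorem3p8 (R : ℝ) (hR : 1 < R) (lam δ : ℕ → ℝ)
    (hlam_pos : ∀ n, 0 < lam n) (hlam : Tendsto lam atTop (𝓝 0))
    (hδ_pos : ∀ n, 0 < δ n) (hδ : Tendsto δ atTop (𝓝 0))
    (hscale : Tendsto (fun n => lam n / Real.sqrt (δ n)) atTop (𝓝 0)) :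
    SpinChain.GammaConverges SpinChain.WeakStarTendsto
      (fun n => SpinChain.scaledHslR R (lam n) (δ n)) SpinChain.limitFunctional where
  liminf_ineq _ _ hz :=
    SpinChain.limitFunctional_le_liminf hlam_pos hlam hδ_pos hδ hscale hz
  recovery z₀ hz₀ := by
    have h1 : ∀ᵐ x ∂SpinChain.muI, ‖z₀ x‖ ≤ 1 := by
      by_contra hcon
      refine hz₀ (if_neg fun h => hcon (h.mono fun x hx => ?_))
      simpa using hx
    obtain ⟨z, hz, hE⟩ :=
      SpinChain.exists_recovery_sequence hR hlam_pos hlam hδ_pos hδ hscale h1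
    exact ⟨z, hz, hE.limsup_eq.trans_le bot_le⟩
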